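/- Let $k$ be a commutative ring (the classical case is $k=\mathbb Z$; "$G$-module" means $kG$-module). Let $G$ be a group, $\{H_\lambda\}_{\lambda\in\Lambda}$ a non-empty family of subgroups, $N_\lambda\lhd H_\lambda$ normal subgroups, $\langle\!\langle\mathcal N\rangle\!\rangle$ the normal closure of $\bigcup_\lambda N_\lambda$ in $G$, $\overline G=G/\langle\!\langle\mathcal N\rangle\!\rangle$ and $\overline H_\lambda=H_\lambda/N_\lambda$. Assume that $(G,\{H_\lambda\},\{N_\lambda\})$ is a Cohen–Lyndon triple, i.e. there are left transversals $T_\lambda$ of $H_\lambda\langle\!\langle\mathcal N\rangle\!\rangle$ in $G$ such that $\langle\!\langle\mathcal N\rangle\!\rangle$ is the free product of its subgroups $tN_\lambda t^{-1}$ ($\lambda\in\Lambda$, $t\in T_\lambda$). Assume also that $H_\lambda\cap\langle\!\langle\mathcal N\rangle\!\rangle=1$ for every $\lambda$ with $N_\lambda=1$. Let $A$ be a $\overline G$-module. For a family of subgroups $\{K_\lambda\}$ of a group $Q$ and a $Q$-module $B$, let $\Delta$ be the kernel of the augmentation $\bigoplus_\lambda k[Q/K_\lambda]\to k$, and put $H_n(Q,\{K_\lambda\};B)=\mathrm{Tor}^{kQ}_{n-1}(\Delta,B)$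 and $H^n(Q,\{K_\lambda\};B)=\mathrm{Ext}_{kQ}^{n-1}(\Delta,B)$, which are $0$ for $n=0$. The long exact sequences of the pair $(Q,\{K_\lambda\})$ are those induced by $0\to\Delta\to\bigoplus_\lambda k[Q/K_\lambda]\to k\to0$ and Shapiro's isomorphisms. Then: (1) The natural maps $\overline H_\lambda\to\overline G$ are injective, so that $\overline H_\lambda$ can be regarded as a subgroup of $\overline G$. (2) The quotient maps $G\to\overline G$ and $H_\lambda\to\overline H_\lambda$ induce a commutative ladder from the long exact sequence $$\cdots\to\bigoplus_\lambda H_i(H_\lambda;A)\xrightarrow{\iota_*}H_i(G;A)\to H_i(G,\{H_\lambda\};A)\to\bigoplus_\lambda H_{i-1}(H_\lambda;A)\to\cdots$$ of the pair $(G,\{H_\lambda\})$ to the long exact sequence $$\cdots\to\bigoplus_\lambda H_i(\overline H_\lambda;A)\xrightarrow{\overline\iota_*}H_i(\overline G;A)\to H_i(\overline G,\{\overline H_\lambda\};A)\to\bigoplus_\lambda H_{i-1}(\overline H_\lambda;A)\to\cdots$$ of the pair $(\overline G,\{\overline H_\lambda\})$, where $\iota_*$ and $\overline\iota_*$ are induced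 by the inclusions. (3) The natural map $H_i(G,\{H_\lambda\};A)\to H_i(\overline G,\{\overline H_\lambda\};A)$ in this ladder is an isomorphism for all $i$ (algebraic excision). (4) Consequently, via this isomorphism, there is an exact sequence $$\cdots\to\bigoplus_\lambda H_i(\overline H_\lambda;A)\xrightarrow{\overline\iota_*}H_i(\overline G;A)\to H_i(G,\{H_\lambda\};A)\to\bigoplus_\lambda H_{i-1}(\overline H_\lambda;A)\to\cdots$$ which receives a commutative ladder from the long exact sequence of $(G,\{H_\lambda\})$ that is the identity on the relative terms $H_i(G,\{H_\lambda\};A)$ and the natural map on the other terms. (5) The analogues of (2)–(4) hold in cohomology, with $\prod_\lambda$ in place of $\bigoplus_\lambda$ and all arrows reversed; in particular $H^i(\overline G,\{\overline H_\lambda\};A)\cong H^i(G,\{H_\lambda\};A)$ for all $i$. -/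

import Mathlib

open CategoryTheory MonoidalCategory
universe u

namespace TensorResolution
noncomputable section
variable {k G : Type u} [CommRing k] [Group G]

theorem projective_tensor (M P : Rep.{u} k G) [Module.Projective k M.V] [Projective P] :
    Projective (M ⊗ P) := by
  have : (ihom M).PreservesEpimorphisms := ⟨fun {X Y} f hf => by
    rw [Rep.epi_iff_surjective] at hf ⊢
    intro φ
    obtain ⟨ψ, hψ⟩ := Module.projective_lifting_property f.hom.toLinearMap
      (show M.V →ₗ[k] Y.V from φ) hf
    exact ⟨(show M.V →ₗ[k] X.V from ψ), hψ⟩⟩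
  exact (ihom.adjunction M).map_projective P inferInstance

theorem preservesHomology_tensorLeft (M : Rep.{u} k G) [Module.Projective k M.V] :
    (tensorLeft M).PreservesHomology := by
  have : (tensorLeft M).PreservesMonomorphisms := ⟨fun {X Y} f hf => by
    rw [Rep.mono_iff_injective] at hf ⊢
    exact Module.Flat.lTensor_preserves_injective_linearMap (M := M.V) f.hom.toLinearMap hf⟩
  exact (tensorLeft M).preservesHomology_of_preservesMonos_and_cokernels

/-- The projective resolution `M ⊗ P → M`, where `P` is the bar resolution of `k`. -/
def resolution (M : Rep.{u} k G) [Module.Projective k M.V] : ProjectiveResolution M where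
  complex := ((tensorLeft M).mapHomologicalComplex _).obj (Rep.barComplex k G)
  projective n := by
    have : Projective ((Rep.barComplex k G).X n) := (Rep.barResolution k G).projective n
    exact projective_tensor M _
  π := ((tensorLeft M).mapHomologicalComplex _).map (Rep.barResolution k G).π ≫
    (HomologicalComplex.singleMapHomologicalComplex (tensorLeft M) _ 0).hom.app _ ≫
      (ChainComplex.single₀ _).map (ρ_ M).hom
  quasiIso := by
    have := preservesHomology_tensorLeft M
    have h : QuasiIso (Rep.barResolution k G).π := (Rep.barResolution k G).quasiIso
    have h1 : QuasiIso (((tensorLeft M).mapHomologicalComplex (ComplexShape.down ℕ)).map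
        (Rep.barResolution k G).π) := inferInstance
    have h2 : QuasiIso ((HomologicalComplex.singleMapHomologicalComplex (tensorLeft M)
        (ComplexShape.down ℕ) 0).hom.app (Rep.trivial k G k)) := inferInstance
    have h3 : QuasiIso ((ChainComplex.single₀ (Rep.{u} k G)).map (ρ_ M).hom) := inferInstance
    exact quasiIso_comp _ _ (hφ := h1) (hφ' := quasiIso_comp _ _ (hφ := h2) (hφ' := h3))

/-- The canonical isomorphism `Tor_n(A, M) ≅ H_n(G; A ⊗ M)` for `M` projective over `k`. -/
def torIso (A M : Rep.{u} k G) [Module.Projective k M.V] (n : ℕ) :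
    ((Rep.Tor k G n).obj A).obj M ≅ groupHomology (A ⊗ M) n := by
  classical
  exact Rep.torIso A (resolution M) n ≪≫
    (HomologicalComplex.homologyFunctor (ModuleCat k) (ComplexShape.down ℕ) n).mapIso
      ((NatIso.mapHomologicalComplex
        (Functor.isoWhiskerRight (tensorLeftTensor A M).symm (Rep.coinvariantsFunctor k G))
          (ComplexShape.down ℕ)).app (Rep.barComplex k G) ≪≫
        (groupHomology.inhomogeneousChainsIso (A ⊗ M)).symm)

/-- The canonical isomorphism `Ext^n(M, A) ≅ H^n(G; Hom(M, A))` for `M` projective over `k`. -/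
def extIso (A M : Rep.{u} k G) [Module.Projective k M.V] (n : ℕ) :
    ((Ext k (Rep k G) n).obj (Opposite.op M)).obj A ≅ groupCohomology ((Rep.ihom M).obj A) n :=
  (resolution M).isoExt n A ≪≫
    (HomologicalComplex.homologyFunctor (ModuleCat k) (ComplexShape.up ℕ) n).mapIso
      ((HomologicalComplex.Hom.isoOfComponents
        (C₁ := (resolution M).complex.linearYonedaObj k A)
        (C₂ := (Rep.barComplex k G).linearYonedaObj k ((Rep.ihom M).obj A))
        (fun i => (Rep.MonoidalClosed.linearHomEquiv M ((Rep.barComplex k G).X i) A).toModuleIso)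
        (by
          rintro i j rfl
          ext f
          rfl)) ≪≫
        (groupCohomology.inhomogeneousCochainsIso ((Rep.ihom M).obj A)).symm)
end
end TensorResolution

namespace GroupPair

noncomputable section

open Representation

section Augmentation

variable {k G Λ : Type u} [CommRing k] [Group G] (H : Λ → Subgroup G)

/-- The `G`-set `⊔_λ G/H_λ`. -/
abbrev Cosets : Type u := Σ l : Λ, G ⧸ H l

variable (k) in
/-- The permutation module `⊕_λ k[G/H_λ]`, realised as `k[⊔_λ G/H_λ]`. -/
abbrev cosetRep : Rep.{u} k G := Rep.ofMulAction k G (Cosets H)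

variable (k) in
/-- The augmentation `⊕_λ k[G/H_λ] → k`, as a linear map. It sends every coset to `1`. -/
def augLin : MonoidAlgebra k (Cosets H) →ₗ[k] k :=
  (Finsupp.linearCombination k fun _ : Cosets H => (1 : k)) ∘ₗ
    (MonoidAlgebra.coeffLinearEquiv k).toLinearMap

@[simp]
theorem augLin_single (x : Cosets H) (r : k) : augLin k H (MonoidAlgebra.single x r) = r := by
  simp [augLin]

theorem augLin_comp (g : G) :
    augLin k H ∘ₗ Representation.ofMulAction k G (Cosets H) g = augLin k H :=
  MonoidAlgebra.lhom_ext' fun x => LinearMap.ext_ring <| by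
    simp only [LinearMap.coe_comp, Function.comp_apply, MonoidAlgebra.lsingle_apply,
      Representation.ofMulAction_single, augLin_single]

@[simp]
theorem augLin_ρ (g : G) (v : MonoidAlgebra k (Cosets H)) :
    augLin k H (Representation.ofMulAction k G (Cosets H) g v) = augLin k H v :=
  LinearMap.congr_fun (augLin_comp H g) v

variable (k) in
/-- The augmentation `⊕_λ k[G/H_λ] → k` as a morphism of representations. -/
def aug : cosetRep k H ⟶ Rep.trivial k G k :=
  Rep.ofHom ⟨augLin k H, fun g => augLin_comp H g⟩

variable (k) in
/-- The `G`-module `Δ`: the kernel of the augmentation `⊕_λ k[G/H_λ] → k`. -/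
abbrev relModule : Rep.{u} k G :=
  Rep.subrepresentation (cosetRep k H) (LinearMap.ker (augLin k H)) fun g v hv =>
    (augLin_ρ H g v).trans hv

variable (k) in
/-- The inclusion `Δ → ⊕_λ k[G/H_λ]`. -/
abbrev relIncl : relModule k H ⟶ cosetRep k H :=
  Rep.subtype (cosetRep k H) (LinearMap.ker (augLin k H)) fun g v hv => (augLin_ρ H g v).trans hv

variable (k) in
/-- A `k`-linear retraction of the inclusion `Δ → ⊕_λ k[G/H_λ]`, depending on a base point. -/
def retr (x : Cosets H) : MonoidAlgebra k (Cosets H) →ₗ[k] LinearMap.ker (augLin k H) :=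
  LinearMap.codRestrict _ (LinearMap.id -
    (LinearMap.toSpanSingleton k (MonoidAlgebra k (Cosets H)) (MonoidAlgebra.single x 1)) ∘ₗ
      augLin k H) fun v => by
        rw [LinearMap.mem_ker]
        simp only [LinearMap.sub_apply, LinearMap.id_coe, id_eq, LinearMap.coe_comp,
          Function.comp_apply, LinearMap.toSpanSingleton_apply, map_sub, map_smul, augLin_single,
          smul_eq_mul, mul_one, sub_self]

theorem retr_subtype (x : Cosets H) :
    retr k H x ∘ₗ (LinearMap.ker (augLin k H)).subtype = LinearMap.id := by
  ext1 v
  apply Subtype.ext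
  have := v.2
  rw [LinearMap.mem_ker] at this
  simp [retr, this]

instance projective_cosetRep : Module.Projective k (cosetRep k H).V :=
  Module.Projective.of_equiv (MonoidAlgebra.coeffLinearEquiv k (M := Cosets H)).symm

instance projective_relModule : Module.Projective k (relModule k H).V := by
  rcases isEmpty_or_nonempty (Cosets H) with h | ⟨⟨x⟩⟩
  · have : Subsingleton (MonoidAlgebra k (Cosets H)) :=
      (MonoidAlgebra.coeffLinearEquiv k (M := Cosets H)).toEquiv.subsingleton
    have : Subsingleton (relModule k H).V := Subtype.val_injective.subsingleton
    infer_instance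
  · exact Module.Projective.of_split (P := LinearMap.ker (augLin k H))
      (LinearMap.ker (augLin k H)).subtype (retr k H x) (retr_subtype H x)

end Augmentation

section Coefficients

theorem shortExact_of_forget {k G : Type u} [CommRing k] [Group G]
    (S : ShortComplex (Rep.{u} k G))
    (h : (S.map (forget₂ (Rep.{u} k G) (ModuleCat.{u} k))).ShortExact) : S.ShortExact where
  exact := (ShortComplex.exact_map_iff_of_faithful S _).1 h.exact
  mono_f := (forget₂ (Rep.{u} k G) (ModuleCat.{u} k)).mono_of_mono_map h.mono_f
  epi_g := (forget₂ (Rep.{u} k G) (ModuleCat.{u} k)).epi_of_epi_map h.epi_g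

variable {k G Λ : Type u} [CommRing k] [Group G] (H : Λ → Subgroup G) (A : Rep.{u} k G)

/-- The projection `A ⊗ (⊕_λ k[G/H_λ]) → A`, sending `a ⊗ v` to `ε(v) a`. -/
def augTensor : A ⊗ cosetRep k H ⟶ A := A ◁ aug k H ≫ (ρ_ A).hom

/-- The sequence `A ⊗ Δ → A ⊗ (⊕_λ k[G/H_λ]) → A`. -/
def homologySeq : ShortComplex (Rep.{u} k G) :=
  ShortComplex.mk (A ◁ relIncl k H) (augTensor H A) (by
    have : relIncl k H ≫ aug k H = 0 :=
      Rep.hom_ext (Representation.IntertwiningMap.ext (LinearMap.ext fun v => v.2))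
    rw [augTensor, ← Category.assoc, ← MonoidalCategory.whiskerLeft_comp, this]
    simp)

/-- The map `A → Hom(⊕_λ k[G/H_λ], A)`, sending `a` to `v ↦ ε(v) a`. -/
def coaug : A ⟶ (Rep.ihom (cosetRep k H)).obj A :=
  Rep.ofHom ⟨((LinearMap.lsmul k A.V) ∘ₗ augLin k H).flip, fun g => by
      refine LinearMap.ext fun a => LinearMap.ext fun (v : MonoidAlgebra k (Cosets H)) => ?_
      change augLin k H v • A.ρ g a = A.ρ g (augLin k H (Representation.ofMulAction k G _ g⁻¹ v) • a)
      rw [augLin_ρ, map_smul]⟩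

/-- Restriction of functions `Hom(⊕_λ k[G/H_λ], A) → Hom(Δ, A)`. -/
def corestr : (Rep.ihom (cosetRep k H)).obj A ⟶ (Rep.ihom (relModule k H)).obj A :=
  Rep.ofHom ⟨LinearMap.lcomp k A.V (LinearMap.ker (augLin k H)).subtype, fun _ => rfl⟩

/-- The sequence `A → Hom(⊕_λ k[G/H_λ], A) → Hom(Δ, A)`. -/
def cohomologySeq : ShortComplex (Rep.{u} k G) :=
  ShortComplex.mk (coaug H A) (corestr H A) (by
    refine Rep.hom_ext (Representation.IntertwiningMap.ext (LinearMap.ext fun a =>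
      LinearMap.ext fun (v : LinearMap.ker (augLin k H)) => ?_))
    change augLin k H v.1 • a = 0
    rw [v.2, zero_smul])

variable [Nonempty Λ]

theorem homologySeq_shortExact : (homologySeq H A).ShortExact := by
  obtain ⟨l⟩ := ‹Nonempty Λ›
  let x : Cosets H := ⟨l, (1 : G)⟩
  refine shortExact_of_forget _ ?_
  refine ShortComplex.Splitting.shortExact
    ⟨ModuleCat.ofHom ((retr k H x).lTensor A.V),
      ModuleCat.ofHom ((TensorProduct.mk k A.V (MonoidAlgebra k (Cosets H))).flip
        (MonoidAlgebra.single x 1)), ?_, ?_, ?_⟩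
  · refine ModuleCat.hom_ext (TensorProduct.ext' fun a v => ?_)
    exact congrArg (fun w => a ⊗ₜ[k] w) (LinearMap.congr_fun (retr_subtype H x) v)
  · refine ModuleCat.hom_ext (LinearMap.ext fun a => ?_)
    change augLin k H (MonoidAlgebra.single x 1) • a = a
    simp
  · refine ModuleCat.hom_ext (TensorProduct.ext' fun a (v : MonoidAlgebra k (Cosets H)) => ?_)
    change a ⊗ₜ[k] (retr k H x v).1 +
      (augLin k H v • a) ⊗ₜ[k] (MonoidAlgebra.single x (1 : k)) = a ⊗ₜ[k] v
    rw [TensorProduct.smul_tmul, ← TensorProduct.tmul_add]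
    simp [retr]

theorem cohomologySeq_shortExact : (cohomologySeq H A).ShortExact := by
  obtain ⟨l⟩ := ‹Nonempty Λ›
  let x : Cosets H := ⟨l, (1 : G)⟩
  refine shortExact_of_forget _ ?_
  refine ShortComplex.Splitting.shortExact
    ⟨ModuleCat.ofHom (LinearMap.applyₗ (M₂ := A.V)
        (MonoidAlgebra.single x (1 : k) : MonoidAlgebra k (Cosets H))),
      ModuleCat.ofHom (LinearMap.lcomp k A.V (retr k H x)), ?_, ?_, ?_⟩
  · refine ModuleCat.hom_ext (LinearMap.ext fun a => ?_)
    change augLin k H (MonoidAlgebra.single x 1) • a = a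
    simp
  · refine ModuleCat.hom_ext (LinearMap.ext fun (f : LinearMap.ker (augLin k H) →ₗ[k] A.V) => ?_)
    change (f ∘ₗ retr k H x) ∘ₗ (LinearMap.ker (augLin k H)).subtype = f
    rw [LinearMap.comp_assoc, retr_subtype, LinearMap.comp_id]
  · refine ModuleCat.hom_ext (LinearMap.ext fun (f : MonoidAlgebra k (Cosets H) →ₗ[k] A.V) =>
      LinearMap.ext fun (v : MonoidAlgebra k (Cosets H)) => ?_)
    change augLin k H v • f (MonoidAlgebra.single x 1) + f (retr k H x v).1 = f v
    rw [← map_smul, ← map_add]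
    simp [retr]

end Coefficients

section Homology

variable {k G Λ : Type u} [CommRing k] [Group G] (H : Λ → Subgroup G) (A : Rep.{u} k G)

/-- The relative homology `H_n(G, {H_λ}; A) = Tor_{n-1}^{kG}(Δ, A)`, where `Tor` is computed from
a projective resolution of `Δ` (and the homology in degree `0` vanishes). -/
def relHomology : ℕ → ModuleCat.{u} k
  | 0 => ModuleCat.of k PUnit
  | n + 1 => ((Rep.Tor k G n).obj A).obj (relModule k H)

/-- The direct sum `⊕_λ H_n(H_λ; A)`. -/
abbrev subHomology (n : ℕ) : Type u :=
  DirectSum Λ fun l => groupHomology (Rep.res (H l).subtype A) n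

/-- The map `⊕_λ H_n(H_λ; A) → H_n(G; A)` induced by the inclusions `H_λ → G`. -/
def homologyIncl (n : ℕ) : subHomology H A n →ₗ[k] groupHomology A n := by
  classical
  exact DirectSum.toModule k Λ _ fun l => (groupHomology.map (H l).subtype (𝟙 _) n).hom

theorem smul_base (l : Λ) {g : G} (hg : g ∈ H l) :
    g • (⟨l, ((1 : G) : G ⧸ H l)⟩ : Cosets H) = ⟨l, ((1 : G) : G ⧸ H l)⟩ := by
  change (⟨l, ((g * 1 : G) : G ⧸ H l)⟩ : Cosets H) = _
  rw [mul_one, (QuotientGroup.eq (s := H l)).2 (by simpa using hg : g⁻¹ * 1 ∈ H l)]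

/-- The `H_λ`-equivariant map `A → A ⊗ (⊕_λ k[G/H_λ])` sending `a` to `a ⊗ [H_λ]`. -/
def toSummand (l : Λ) :
    Rep.res (H l).subtype A ⟶ Rep.res (H l).subtype (A ⊗ cosetRep k H) :=
  Rep.ofHom ⟨(TensorProduct.mk k A.V (MonoidAlgebra k (Cosets H))).flip
    (MonoidAlgebra.single (⟨l, (1 : G)⟩ : Cosets H) 1), fun g => by
      refine LinearMap.ext fun a => ?_
      change A.ρ (g : G) a ⊗ₜ[k] _ = A.ρ (g : G) a ⊗ₜ[k]
        Representation.ofMulAction k G (Cosets H) (g : G)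
          (MonoidAlgebra.single (⟨l, (1 : G)⟩ : Cosets H) (1 : k))
      rw [Representation.ofMulAction_single, smul_base H l g.2]⟩

/-- Shapiro's map `⊕_λ H_n(H_λ; A) → H_n(G; A ⊗ (⊕_λ k[G/H_λ]))`. -/
def homologyShapiro (n : ℕ) : subHomology H A n →ₗ[k] groupHomology (A ⊗ cosetRep k H) n := by
  classical
  exact DirectSum.toModule k Λ _ fun l =>
    (groupHomology.map (H l).subtype (toSummand H A l) n).hom

/-- The canonical isomorphism `H_{n+1}(G, {H_λ}; A) ≅ H_n(G; A ⊗ Δ)`. -/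
def relHomologyIso (n : ℕ) : relHomology H A (n + 1) ≅ groupHomology (A ⊗ relModule k H) n :=
  TensorResolution.torIso A (relModule k H) n

/-- The map `H_n(G; A) → H_n(G, {H_λ}; A)` of the long exact sequence of the pair: the connecting
homomorphism of `0 → A ⊗ Δ → A ⊗ (⊕_λ k[G/H_λ]) → A → 0`. -/
def homologyToRel [Nonempty Λ] : ∀ n, groupHomology A n →ₗ[k] relHomology H A n
  | 0 => 0
  | n + 1 => (groupHomology.δ (homologySeq_shortExact H A) (n + 1) n rfl ≫
      (relHomologyIso H A n).inv).hom

/-- The map `H_{n+1}(G, {H_λ}; A) → H_n(G; A ⊗ (⊕_λ k[G/H_λ]))` induced by the inclusion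
`Δ → ⊕_λ k[G/H_λ]`. -/
def relToCoset (n : ℕ) : relHomology H A (n + 1) →ₗ[k] groupHomology (A ⊗ cosetRep k H) n :=
  ((relHomologyIso H A n).hom ≫ groupHomology.map (MonoidHom.id G) (homologySeq H A).f n).hom

/-- `d` is the map `H_{n+1}(G, {H_λ}; A) → ⊕_λ H_n(H_λ; A)` of the long exact sequence of the pair:
it is the map induced by `Δ → ⊕_λ k[G/H_λ]`, followed by the inverse of Shapiro's isomorphism. -/
def IsHomologyBoundary (n : ℕ) (d : relHomology H A (n + 1) →ₗ[k] subHomology H A n) : Prop :=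
  homologyShapiro H A n ∘ₗ d = relToCoset H A n

/-- Exactness of
`⋯ → L (n+1) → M (n+1) → R (n+1) → L n → ⋯ → L 0 → M 0 → R 0 → 0`. -/
structure IsLongExactHomology {L M R : ℕ → Type u} [∀ n, AddCommGroup (L n)]
    [∀ n, AddCommGroup (M n)] [∀ n, AddCommGroup (R n)] [∀ n, Module k (L n)]
    [∀ n, Module k (M n)] [∀ n, Module k (R n)] (i : ∀ n, L n →ₗ[k] M n)
    (j : ∀ n, M n →ₗ[k] R n) (d : ∀ n, R (n + 1) →ₗ[k] L n) : Prop where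
  exact_mid (n : ℕ) : Function.Exact (i n) (j n)
  exact_rel (n : ℕ) : Function.Exact (j (n + 1)) (d n)
  exact_sub (n : ℕ) : Function.Exact (d n) (i n)
  surjective_zero : Function.Surjective (j 0)

end Homology

section Cohomology

variable {k G Λ : Type u} [CommRing k] [Group G] (H : Λ → Subgroup G) (A : Rep.{u} k G)

/-- The relative cohomology `H^n(G, {H_λ}; A) = Ext^{n-1}_{kG}(Δ, A)` (which vanishes for
`n = 0`). -/
def relCohomology : ℕ → ModuleCat.{u} k
  | 0 => ModuleCat.of k PUnit
  | n + 1 => ((Ext k (Rep.{u} k G) n).obj (Opposite.op (relModule k H))).obj A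

/-- The product `∏_λ H^n(H_λ; A)`. -/
abbrev subCohomology (n : ℕ) : Type u :=
  ∀ l, groupCohomology (Rep.res (H l).subtype A) n

/-- The map `H^n(G; A) → ∏_λ H^n(H_λ; A)` induced by the inclusions `H_λ → G`. -/
def cohomologyRestr (n : ℕ) : groupCohomology A n →ₗ[k] subCohomology H A n :=
  LinearMap.pi fun l => (groupCohomology.map (H l).subtype (𝟙 _) n).hom

/-- The `H_λ`-equivariant map `Hom(⊕_λ k[G/H_λ], A) → A`, evaluation at the coset `[H_λ]`. -/
def evalSummand (l : Λ) :
    Rep.res (H l).subtype ((Rep.ihom (cosetRep k H)).obj A) ⟶ Rep.res (H l).subtype A :=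
  Rep.ofHom ⟨LinearMap.applyₗ (M₂ := A.V)
    (MonoidAlgebra.single (⟨l, (1 : G)⟩ : Cosets H) (1 : k)), fun g => by
      refine LinearMap.ext fun (f : MonoidAlgebra k (Cosets H) →ₗ[k] A.V) => ?_
      change A.ρ (g : G) (f (Representation.ofMulAction k G (Cosets H) (g : G)⁻¹
        (MonoidAlgebra.single _ 1))) = A.ρ (g : G) (f _)
      rw [Representation.ofMulAction_single, smul_base H l (inv_mem g.2)]⟩

/-- Shapiro's map `H^n(G; Hom(⊕_λ k[G/H_λ], A)) → ∏_λ H^n(H_λ; A)`. -/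
def cohomologyShapiro (n : ℕ) :
    groupCohomology ((Rep.ihom (cosetRep k H)).obj A) n →ₗ[k] subCohomology H A n :=
  LinearMap.pi fun l => (groupCohomology.map (H l).subtype (evalSummand H A l) n).hom

/-- The canonical isomorphism `H^{n+1}(G, {H_λ}; A) ≅ H^n(G; Hom(Δ, A))`. -/
def relCohomologyIso (n : ℕ) :
    relCohomology H A (n + 1) ≅ groupCohomology ((Rep.ihom (relModule k H)).obj A) n :=
  TensorResolution.extIso A (relModule k H) n

/-- The map `H^n(G, {H_λ}; A) → H^n(G; A)` of the long exact sequence of the pair: the connecting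
homomorphism of `0 → A → Hom(⊕_λ k[G/H_λ], A) → Hom(Δ, A) → 0`. -/
def relToCohomology [Nonempty Λ] : ∀ n, relCohomology H A n →ₗ[k] groupCohomology A n
  | 0 => 0
  | n + 1 => ((relCohomologyIso H A n).hom ≫
      groupCohomology.δ (cohomologySeq_shortExact H A) n (n + 1) rfl).hom

/-- The map `H^n(G; Hom(⊕_λ k[G/H_λ], A)) → H^{n+1}(G, {H_λ}; A)` induced by the inclusion
`Δ → ⊕_λ k[G/H_λ]`. -/
def cosetToRel (n : ℕ) :
    groupCohomology ((Rep.ihom (cosetRep k H)).obj A) n →ₗ[k] relCohomology H A (n + 1) :=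
  (groupCohomology.map (MonoidHom.id G) (cohomologySeq H A).g n ≫ (relCohomologyIso H A n).inv).hom

/-- `d` is the map `∏_λ H^n(H_λ; A) → H^{n+1}(G, {H_λ}; A)` of the long exact sequence of the pair:
it is the inverse of Shapiro's isomorphism, followed by the map induced by
`Δ → ⊕_λ k[G/H_λ]`. -/
def IsCohomologyCoboundary (n : ℕ)
    (d : subCohomology H A n →ₗ[k] relCohomology H A (n + 1)) : Prop :=
  d ∘ₗ cohomologyShapiro H A n = cosetToRel H A n

/-- Exactness of
`0 → R 0 → M 0 → L 0 → ⋯ → L n → R (n+1) → M (n+1) → L (n+1) → ⋯`. -/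
structure IsLongExactCohomology {L M R : ℕ → Type u} [∀ n, AddCommGroup (L n)]
    [∀ n, AddCommGroup (M n)] [∀ n, AddCommGroup (R n)] [∀ n, Module k (L n)]
    [∀ n, Module k (M n)] [∀ n, Module k (R n)] (r : ∀ n, M n →ₗ[k] L n)
    (p : ∀ n, R n →ₗ[k] M n) (d : ∀ n, L n →ₗ[k] R (n + 1)) : Prop where
  injective_zero : Function.Injective (p 0)
  exact_mid (n : ℕ) : Function.Exact (p n) (r n)
  exact_sub (n : ℕ) : Function.Exact (r n) (d n)
  exact_rel (n : ℕ) : Function.Exact (d n) (p (n + 1))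

end Cohomology

section Functoriality

variable {k G Q Λ : Type u} [CommRing k] [Group G] [Group Q] {H : Λ → Subgroup G}
  {K : Λ → Subgroup Q} (f : G →* Q) (hf : ∀ l, H l ≤ (K l).comap f) (A : Rep.{u} k Q)

/-- The restriction `H_λ → K_λ` of `f : G → Q`. -/
def subMap (l : Λ) : H l →* K l :=
  (f.comp (H l).subtype).codRestrict (K l) fun h => hf l h.2

/-- The map `⊔_λ G/H_λ → ⊔_λ Q/K_λ` induced by `f : G → Q`. -/
def cosetMap : Cosets H → Cosets K :=
  Sigma.map id fun l => Quotient.map' f fun a b hab => by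
    rw [QuotientGroup.leftRel_apply] at hab ⊢
    simpa using hf l hab

theorem cosetMap_smul (g : G) (x : Cosets H) :
    cosetMap f hf (g • x) = f g • cosetMap f hf x := by
  obtain ⟨l, x⟩ := x
  induction x using QuotientGroup.induction_on with
  | H z =>
    change (⟨l, ((f (g * z) : Q) : Q ⧸ K l)⟩ : Cosets K) = ⟨l, ((f g * f z : Q) : Q ⧸ K l)⟩
    rw [map_mul]

variable (k) in
/-- The linear map `⊕_λ k[G/H_λ] → ⊕_λ k[Q/K_λ]` induced by `f : G → Q`. -/
def cosetLin : MonoidAlgebra k (Cosets H) →ₗ[k] MonoidAlgebra k (Cosets K) :=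
  (MonoidAlgebra.coeffLinearEquiv k).symm.toLinearMap ∘ₗ
    Finsupp.lmapDomain k k (cosetMap f hf) ∘ₗ (MonoidAlgebra.coeffLinearEquiv k).toLinearMap

@[simp]
theorem cosetLin_single (x : Cosets H) (r : k) :
    cosetLin k f hf (MonoidAlgebra.single x r) = MonoidAlgebra.single (cosetMap f hf x) r := by
  simp [cosetLin]

theorem augLin_cosetLin (v : MonoidAlgebra k (Cosets H)) :
    augLin k K (cosetLin k f hf v) = augLin k H v := by
  have : augLin k K ∘ₗ cosetLin k f hf = augLin k H :=
    MonoidAlgebra.lhom_ext' fun x => LinearMap.ext_ring <| by simp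
  exact LinearMap.congr_fun this v

theorem cosetLin_ρ (g : G) (v : MonoidAlgebra k (Cosets H)) :
    cosetLin k f hf (Representation.ofMulAction k G (Cosets H) g v) =
      Representation.ofMulAction k Q (Cosets K) (f g) (cosetLin k f hf v) := by
  have : cosetLin k f hf ∘ₗ Representation.ofMulAction k G (Cosets H) g =
      Representation.ofMulAction k Q (Cosets K) (f g) ∘ₗ cosetLin k f hf :=
    MonoidAlgebra.lhom_ext' fun x => LinearMap.ext_ring <| by simp [cosetMap_smul]
  exact LinearMap.congr_fun this v

variable (k) in
/-- The map `Δ_G → Δ_Q` induced by `f : G → Q`. -/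
def relModuleMap : relModule k H ⟶ Rep.res f (relModule k K) :=
  Rep.ofHom ⟨(cosetLin k f hf).restrict fun v hv => (augLin_cosetLin f hf v).trans hv, fun g =>
    LinearMap.ext fun (v : LinearMap.ker (augLin k H)) => Subtype.ext (cosetLin_ρ f hf g v.1)⟩

/-- The `G`-equivariant map `A ⊗ Δ_G → A ⊗ Δ_Q`. -/
def relTensorMap : Rep.res f A ⊗ relModule k H ⟶ Rep.res f (A ⊗ relModule k K) :=
  Rep.ofHom ⟨(relModuleMap k f hf).hom.toLinearMap.lTensor A.V, fun g =>
    TensorProduct.ext' fun a (v : LinearMap.ker (augLin k H)) =>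
      congrArg (fun w => A.ρ (f g) a ⊗ₜ[k] w) (Rep.hom_comm_apply (relModuleMap k f hf) g v)⟩

/-- The `G`-equivariant map `Hom(Δ_Q, A) → Hom(Δ_G, A)`. -/
def relHomMap : Rep.res f ((Rep.ihom (relModule k K)).obj A) ⟶
    (Rep.ihom (relModule k H)).obj (Rep.res f A) :=
  Rep.ofHom ⟨LinearMap.lcomp k A.V (relModuleMap k f hf).hom.toLinearMap, fun g => by
    refine LinearMap.ext fun (φ : LinearMap.ker (augLin k K) →ₗ[k] A.V) =>
      LinearMap.ext fun (v : LinearMap.ker (augLin k H)) => ?_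
    have := (Rep.hom_comm_apply (relModuleMap k f hf) g⁻¹ v).symm
    rw [Rep.coe_res_obj_ρ', map_inv] at this
    exact congrArg (fun w => A.ρ (f g) (φ w)) this⟩

/-- The natural map `⊕_λ H_n(H_λ; A) → ⊕_λ H_n(K_λ; A)`. -/
def subHomologyMap (n : ℕ) : subHomology H (Rep.res f A) n →ₗ[k] subHomology K A n :=
  DirectSum.lmap fun l => (groupHomology.map (A := Rep.res (H l).subtype (Rep.res f A))
    (B := Rep.res (K l).subtype A) (subMap f hf l) (𝟙 _) n).hom

/-- The natural map `H_n(G; A) → H_n(Q; A)`. -/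
def homologyMap (n : ℕ) : groupHomology (Rep.res f A) n →ₗ[k] groupHomology A n :=
  (groupHomology.map f (𝟙 _) n).hom

/-- The natural map `H_n(G, {H_λ}; A) → H_n(Q, {K_λ}; A)`. -/
def relHomologyMap : ∀ n, relHomology H (Rep.res f A) n →ₗ[k] relHomology K A n
  | 0 => 0
  | n + 1 => ((relHomologyIso H (Rep.res f A) n).hom ≫
      groupHomology.map f (relTensorMap f hf A) n ≫ (relHomologyIso K A n).inv).hom

/-- The natural map `∏_λ H^n(K_λ; A) → ∏_λ H^n(H_λ; A)`. -/
def subCohomologyMap (n : ℕ) : subCohomology K A n →ₗ[k] subCohomology H (Rep.res f A) n :=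
  LinearMap.pi fun l => (groupCohomology.map (A := Rep.res (K l).subtype A)
    (B := Rep.res (H l).subtype (Rep.res f A)) (subMap f hf l) (𝟙 _) n).hom ∘ₗ LinearMap.proj l

/-- The natural map `H^n(Q; A) → H^n(G; A)`. -/
def cohomologyMap (n : ℕ) : groupCohomology A n →ₗ[k] groupCohomology (Rep.res f A) n :=
  (groupCohomology.map f (𝟙 _) n).hom

/-- The natural map `H^n(Q, {K_λ}; A) → H^n(G, {H_λ}; A)`. -/
def relCohomologyMap : ∀ n, relCohomology K A n →ₗ[k] relCohomology H (Rep.res f A) n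
  | 0 => 0
  | n + 1 => ((relCohomologyIso K A n).hom ≫
      groupCohomology.map f (relHomMap f hf A) n ≫ (relCohomologyIso H (Rep.res f A) n).inv).hom

end Functoriality

end

end GroupPair

namespace DehnFilling

noncomputable section

variable {G Λ : Type u} [Group G] (H : Λ → Subgroup G) (N : ∀ l, Subgroup (H l))

/-- `N_λ` as a subgroup of `G`. -/
abbrev kernelIn (l : Λ) : Subgroup G := (N l).map (H l).subtype

/-- The normal closure of `⋃_λ N_λ` in `G`. -/
def normalHull : Subgroup G := Subgroup.normalClosure (⋃ l, (kernelIn H N l : Set G))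

instance normalHull_normal : (normalHull H N).Normal := Subgroup.normalClosure_normal

/-- The quotient `Ḡ = G/⟪⋃_λ N_λ⟫`. -/
abbrev Filling : Type u := G ⧸ normalHull H N

/-- The quotient map `G → Ḡ`. -/
abbrev proj : G →* Filling H N := QuotientGroup.mk' (normalHull H N)

/-- The conjugate `t N_λ t⁻¹`. -/
abbrev conjKernel (l : Λ) (t : G) : Subgroup G :=
  (kernelIn H N l).map (MulAut.conj t).toMonoidHom

/-- `(G, {H_λ}, {N_λ})` is a Cohen–Lyndon triple: there are left transversals `T_λ` of
`H_λ⟪⋃_λ N_λ⟫` in `G` such that `⟪⋃_λ N_λ⟫` is the (internal) free product of the subgroups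
`t N_λ t⁻¹`, where `λ ∈ Λ` and `t ∈ T_λ`. -/
def IsCohenLyndon : Prop :=
  ∃ T : Λ → Set G,
    (∀ l, Subgroup.IsComplement (T l) ((H l ⊔ normalHull H N : Subgroup G) : Set G)) ∧
    Function.Injective (Monoid.CoprodI.lift fun p : Σ l, T l => (conjKernel H N p.1 p.2).subtype) ∧
    (Monoid.CoprodI.lift fun p : Σ l, T l => (conjKernel H N p.1 p.2).subtype).range =
      normalHull H N

variable [∀ l, (N l).Normal]

/-- The natural homomorphism `H̄_λ = H_λ/N_λ → Ḡ`. -/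
def barHom (l : Λ) : H l ⧸ N l →* Filling H N :=
  QuotientGroup.lift (N l) ((proj H N).comp (H l).subtype) fun n hn =>
    (QuotientGroup.eq_one_iff (n : G)).2
      (Subgroup.subset_normalClosure (Set.mem_iUnion.2 ⟨l, ⟨n, hn, rfl⟩⟩))

/-- The image of `H̄_λ = H_λ/N_λ` in `Ḡ`. -/
def barSubgroup (l : Λ) : Subgroup (Filling H N) := (barHom H N l).range

theorem le_comap_barSubgroup (l : Λ) : H l ≤ (barSubgroup H N l).comap (proj H N) :=
  fun h hh => ⟨((⟨h, hh⟩ : H l) : H l ⧸ N l), rfl⟩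

end

end DehnFilling

/-! Write 𝒩 for the normal hull of the N_λ and Q = G/𝒩, and let Δ and Δ̄ be the augmentation kernels
for G and Q. Excision is a statement about one `G`-module: the relative groups are Tor and Ext of Δ,
respectively Δ̄, and two facts about Δ suffice. First, Δ is projective over k𝒩. Second, the
𝒩-coinvariants of Δ are Δ̄. Morally, Δ is then acyclic for 𝒩-coinvariants, so Tor^{kG}(Δ, A) =
Tor^{kQ}(Δ_𝒩, A) = Tor^{kQ}(Δ̄, A), and likewise for Ext.

Both facts come from the action of 𝒩 on the cosets ⊔ G/H_λ. The cosets tH_λ with t ∈ T_λ represent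
its orbits, since T_λ is a transversal of H_λ𝒩, and the stabiliser of tH_λ is t(H_λ ∩ 𝒩)t⁻¹. The
equality H_λ ∩ 𝒩 = N_λ, which also gives injectivity of H̄_λ → Ḡ, holds because a nontrivial free
factor is malnormal (`Monoid.CoprodI.mem_range_of_of_conj`); for trivial N_λ it is assumed. So the
stabilisers are exactly the free factors of 𝒩. Freeness then makes Δ a direct summand of a free
k𝒩-module (`GroupPair.projective_res_relModule`), an algebraic substitute for the action of a free
product on its Bass–Serre tree. Generation by elements fixing some coset gives the coinvariants
(`cosetSub_smul_mem`, `GroupPair.mem_ker_of_relModuleMap_eq_zero`).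

The spectral sequence is replaced by dimension shifting in A. The sequences A ⊗ Δ₁ → A ⊗ k[Q] → A
and A → Hom(k[Q], A) → Hom(Δ₁, A), with Δ₁ the augmentation kernel of k[Q], have middle terms that
are acyclic both for Q with Δ̄ and for G with Δ. For G the reason is that k[Q] ⊗ Δ is induced from
the restriction of Δ to 𝒩, hence projective (`projective_regularRep_tensor`). Excision in all
degrees follows from degree 0, where it is a comparison of coinvariants or invariants
(`bijective_map_tensorMap_zero`, `bijective_map_ihomMap_zero`).

Shapiro's isomorphism for a family of subgroups is proved by the same shifting argument. It turns
the coefficient long exact sequences into those of the pairs; naturality of connecting maps and of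
Shapiro's maps gives the ladders. -/

section Modules

/-! ### Diagram chases in modules. -/

variable {k : Type*} [CommRing k] {X₁ X₂ X₃ Y₁ Y₂ Y₃ : Type*}
  [AddCommGroup X₁] [AddCommGroup X₂] [AddCommGroup X₃]
  [AddCommGroup Y₁] [AddCommGroup Y₂] [AddCommGroup Y₃]
  [Module k X₁] [Module k X₂] [Module k X₃] [Module k Y₁] [Module k Y₂] [Module k Y₃]
  {u : X₁ →ₗ[k] X₂} {v : X₂ →ₗ[k] X₃} {u' : Y₁ →ₗ[k] Y₂} {v' : Y₂ →ₗ[k] Y₃}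
  {a₁ : X₁ →ₗ[k] Y₁} {a₂ : X₂ →ₗ[k] Y₂} {a₃ : X₃ →ₗ[k] Y₃}

/-- The inductive step of dimension shifting in homology: the first terms are kernels of maps on
which the comparison is already understood. -/
theorem LinearMap.bijective_of_leftExact (h : Function.Exact u v) (hu : Function.Injective u)
    (h' : Function.Exact u' v') (hu' : Function.Injective u')
    (h₁₂ : a₂ ∘ₗ u = u' ∘ₗ a₁) (h₂₃ : a₃ ∘ₗ v = v' ∘ₗ a₂)
    (h₂ : Function.Bijective a₂) (h₃ : Function.Injective a₃) : Function.Bijective a₁ := by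
  constructor
  · refine Function.Injective.of_comp (f := u') ?_
    rw [← LinearMap.coe_comp, ← h₁₂]
    exact h₂.1.comp hu
  · intro y
    obtain ⟨x, hx⟩ := h₂.2 (u' y)
    obtain ⟨z, rfl⟩ := (h x).1 (h₃ (by
      rw [map_zero]
      exact (LinearMap.congr_fun h₂₃ x).trans ((congrArg v' hx).trans (h'.apply_apply_eq_zero y))))
    exact ⟨z, hu' ((LinearMap.congr_fun h₁₂ z).symm.trans hx)⟩

/-- The dual step, for cohomology: the last terms are cokernels. -/
theorem LinearMap.bijective_of_rightExact (h : Function.Exact u v) (hv : Function.Surjective v)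
    (h' : Function.Exact u' v') (hv' : Function.Surjective v')
    (h₁₂ : a₂ ∘ₗ u = u' ∘ₗ a₁) (h₂₃ : a₃ ∘ₗ v = v' ∘ₗ a₂)
    (h₁ : Function.Surjective a₁) (h₂ : Function.Bijective a₂) : Function.Bijective a₃ := by
  constructor
  · rw [injective_iff_map_eq_zero]
    intro z hz
    obtain ⟨x, rfl⟩ := hv z
    obtain ⟨y, hy⟩ := (h' (a₂ x)).1 ((LinearMap.congr_fun h₂₃ x).symm.trans hz)
    obtain ⟨w, rfl⟩ := h₁ y
    have : u w = x := h₂.1 ((LinearMap.congr_fun h₁₂ w).trans hy)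
    rw [← this, h.apply_apply_eq_zero]
  · refine Function.Surjective.of_comp (g := v) ?_
    rw [← LinearMap.coe_comp, h₂₃]
    exact hv'.comp h₂.2

theorem LinearMap.injective_of_exact [Subsingleton X₁] (h : Function.Exact u v) :
    Function.Injective v := by
  rw [injective_iff_map_eq_zero]
  intro y hy
  obtain ⟨x, rfl⟩ := (h y).1 hy
  rw [Subsingleton.elim x 0, map_zero]

theorem LinearMap.surjective_of_exact [Subsingleton X₃] (h : Function.Exact u v) :
    Function.Surjective u :=
  fun y => (h y).1 (Subsingleton.elim _ _)

theorem LinearMap.exact_pi {ι : Type*} {X Y Z : ι → Type*} [∀ i, AddCommGroup (X i)]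
    [∀ i, AddCommGroup (Y i)] [∀ i, AddCommGroup (Z i)] [∀ i, Module k (X i)]
    [∀ i, Module k (Y i)] [∀ i, Module k (Z i)] {u : ∀ i, X i →ₗ[k] Y i} {v : ∀ i, Y i →ₗ[k] Z i}
    (h : ∀ i, Function.Exact (u i) (v i)) :
    Function.Exact (LinearMap.pi fun i => u i ∘ₗ LinearMap.proj i)
      (LinearMap.pi fun i => v i ∘ₗ LinearMap.proj i) := by
  intro y
  constructor
  · intro hy
    choose x hx using fun i => (h i (y i)).1 (congrFun hy i)
    exact ⟨x, funext hx⟩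
  · rintro ⟨x, rfl⟩
    exact funext fun i => (h i).apply_apply_eq_zero (x i)

theorem DirectSum.exact_lmap {ι : Type*} {X Y Z : ι → Type*} [∀ i, AddCommGroup (X i)]
    [∀ i, AddCommGroup (Y i)] [∀ i, AddCommGroup (Z i)] [∀ i, Module k (X i)]
    [∀ i, Module k (Y i)] [∀ i, Module k (Z i)] {u : ∀ i, X i →ₗ[k] Y i} {v : ∀ i, Y i →ₗ[k] Z i}
    (h : ∀ i, Function.Exact (u i) (v i)) :
    Function.Exact (DirectSum.lmap u) (DirectSum.lmap v) := by
  rw [LinearMap.exact_iff, DirectSum.ker_lmap, DirectSum.range_lmap]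
  simp_rw [fun i => LinearMap.exact_iff.1 (h i)]

end Modules

/-! ### Exactness, change of groups and degree zero in group (co)homology. -/

section Homology

variable {k G Q : Type u} [CommRing k] [Group G] [Group Q]

namespace groupHomology

theorem exact_map_map (S : ShortComplex (Rep.{u} k G)) (hS : S.ShortExact) (n : ℕ) :
    Function.Exact (map (MonoidHom.id G) S.f n).hom (map (MonoidHom.id G) S.g n).hom :=
  (ShortComplex.ShortExact.moduleCat_exact_iff_function_exact _).1 (mapShortComplex₂_exact hS n)

theorem exact_map_δ (S : ShortComplex (Rep.{u} k G)) (hS : S.ShortExact) (n : ℕ) :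
    Function.Exact (map (MonoidHom.id G) S.g (n + 1)).hom (δ hS (n + 1) n rfl).hom :=
  (ShortComplex.ShortExact.moduleCat_exact_iff_function_exact _).1 (mapShortComplex₃_exact hS rfl)

theorem exact_δ_map (S : ShortComplex (Rep.{u} k G)) (hS : S.ShortExact) (n : ℕ) :
    Function.Exact (δ hS (n + 1) n rfl).hom (map (MonoidHom.id G) S.f n).hom :=
  (ShortComplex.ShortExact.moduleCat_exact_iff_function_exact _).1 (mapShortComplex₁_exact hS rfl)

theorem surjective_map_zero (S : ShortComplex (Rep.{u} k G)) (hS : S.ShortExact) :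
    Function.Surjective (map (MonoidHom.id G) S.g 0).hom := by
  have := hS.epi_g
  exact (ModuleCat.epi_iff_surjective _).1 (epi_map_0_of_epi S.g)

/-- At the level of chains, `f` and `τ` give a morphism of short exact sequences of complexes, and
connecting maps are natural. Allowing the group to change covers both Shapiro's maps (`f` a subgroup
inclusion) and the ladder (`f` the quotient map). -/
theorem δ_comp_map {S : ShortComplex (Rep.{u} k G)} (hS : S.ShortExact)
    {S' : ShortComplex (Rep.{u} k Q)} (hS' : S'.ShortExact) (f : G →* Q)
    (τ : S ⟶ S'.map (Rep.resFunctor f)) (n : ℕ) :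
    δ hS (n + 1) n rfl ≫ map f τ.τ₁ n = map f τ.τ₃ (n + 1) ≫ δ hS' (n + 1) n rfl := by
  let φ : S.map (chainsFunctor k G) ⟶ S'.map (chainsFunctor k Q) :=
    { τ₁ := chainsMap f τ.τ₁
      τ₂ := chainsMap f τ.τ₂
      τ₃ := chainsMap f τ.τ₃
      comm₁₂ := by
        refine (chainsMap_comp f (MonoidHom.id Q) τ.τ₁ S'.f).symm.trans
          (Eq.trans ?_ (chainsMap_comp (MonoidHom.id G) f S.f τ.τ₂))
        exact chainsMap_congr rfl (congrArg (fun t => t.hom.toLinearMap) τ.comm₁₂)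
      comm₂₃ := by
        refine (chainsMap_comp f (MonoidHom.id Q) τ.τ₂ S'.g).symm.trans
          (Eq.trans ?_ (chainsMap_comp (MonoidHom.id G) f S.g τ.τ₃))
        exact chainsMap_congr rfl (congrArg (fun t => t.hom.toLinearMap) τ.comm₂₃) }
  exact HomologicalComplex.HomologySequence.δ_naturality φ (map_chainsFunctor_shortExact hS)
    (map_chainsFunctor_shortExact hS') (n + 1) n rfl

theorem map_comp_map (f : G →* Q) {A A' : Rep.{u} k G} {B B' : Rep.{u} k Q}
    {φ : A ⟶ Rep.res f B} {φ' : A' ⟶ Rep.res f B'} {a : A ⟶ A'} {b : B ⟶ B'}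
    (h : a ≫ φ' = φ ≫ (Rep.resFunctor f).map b) (n : ℕ) :
    map (MonoidHom.id G) a n ≫ map f φ' n = map f φ n ≫ map (MonoidHom.id Q) b n :=
  (map_comp (MonoidHom.id G) f a φ' n).symm.trans
    ((map_congr rfl (congrArg (fun t => t.hom.toLinearMap) h) n).trans
      (map_comp f (MonoidHom.id Q) φ b n))

theorem map_H0π (f : G →* Q) {A : Rep.{u} k G} {B : Rep.{u} k Q} (φ : A ⟶ Rep.res f B) (a : A) :
    (map f φ 0).hom (H0π A a) = H0π B (φ.hom a) :=
  LinearMap.congr_fun (congrArg ModuleCat.Hom.hom (H0π_comp_map f φ)) a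

theorem surjective_H0π (A : Rep.{u} k G) : Function.Surjective (H0π A) :=
  (ModuleCat.epi_iff_surjective _).1 inferInstance

theorem H0π_eq_zero_iff (A : Rep.{u} k G) (a : A) :
    H0π A a = 0 ↔ a ∈ Representation.Coinvariants.ker A.ρ := by
  have h : (H0Iso A).hom (H0π A a) = (Representation.Coinvariants.mk A.ρ a) :=
    LinearMap.congr_fun (congrArg ModuleCat.Hom.hom (H0π_comp_H0Iso_hom A)) a
  rw [← Representation.Coinvariants.mk_eq_zero, ← h]
  have hi : Function.Injective (H0Iso A).hom :=
    (ModuleCat.mono_iff_injective _).1 inferInstance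
  exact (map_eq_zero_iff _ hi).symm

theorem exists_H0_lift (A : Rep.{u} k G) {Z : Type*} [AddCommGroup Z] [Module k Z]
    (r : A.V →ₗ[k] Z) (h : ∀ g, r ∘ₗ A.ρ g = r) :
    ∃ R : groupHomology A 0 →ₗ[k] Z, ∀ a, R (H0π A a) = r a :=
  ⟨Representation.Coinvariants.lift A.ρ r h ∘ₗ (H0Iso A).hom.hom, fun a =>
    congrArg (Representation.Coinvariants.lift A.ρ r h)
      (LinearMap.congr_fun (congrArg ModuleCat.Hom.hom (H0π_comp_H0Iso_hom A)) a)⟩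

theorem subsingleton_of_iso {A B : Rep.{u} k G} (e : A ≅ B) (n : ℕ)
    [h : Subsingleton (groupHomology B n)] : Subsingleton (groupHomology A n) :=
  have : Subsingleton ((functor k G n).obj B) := h
  ((functor k G n).mapIso e).toLinearEquiv.toEquiv.subsingleton

/-- These groups are Tor_{n+1}(A, M), which vanish on projective `M`. This and its Ext analogue are
the source of all acyclicity below. -/
theorem subsingleton_tensor_of_projective (A M : Rep.{u} k G) [Module.Projective k M.V]
    [Projective M] (n : ℕ) : Subsingleton (groupHomology (A ⊗ M) (n + 1)) :=
  ModuleCat.subsingleton_of_isZero ((Rep.isZero_Tor_succ_of_projective A M n).of_iso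
    (TensorResolution.torIso A M (n + 1)).symm)

end groupHomology

namespace groupCohomology

theorem exact_map_map (S : ShortComplex (Rep.{u} k G)) (hS : S.ShortExact) (n : ℕ) :
    Function.Exact (map (MonoidHom.id G) S.f n).hom (map (MonoidHom.id G) S.g n).hom :=
  (ShortComplex.ShortExact.moduleCat_exact_iff_function_exact _).1 (mapShortComplex₂_exact hS n)

theorem exact_map_δ (S : ShortComplex (Rep.{u} k G)) (hS : S.ShortExact) (n : ℕ) :
    Function.Exact (map (MonoidHom.id G) S.g n).hom (δ hS n (n + 1) rfl).hom :=
  (ShortComplex.ShortExact.moduleCat_exact_iff_function_exact _).1 (mapShortComplex₃_exact hS rfl)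

theorem exact_δ_map (S : ShortComplex (Rep.{u} k G)) (hS : S.ShortExact) (n : ℕ) :
    Function.Exact (δ hS n (n + 1) rfl).hom (map (MonoidHom.id G) S.f (n + 1)).hom :=
  (ShortComplex.ShortExact.moduleCat_exact_iff_function_exact _).1 (mapShortComplex₁_exact hS rfl)

theorem injective_map_zero (S : ShortComplex (Rep.{u} k G)) (hS : S.ShortExact) :
    Function.Injective (map (MonoidHom.id G) S.f 0).hom := by
  have := hS.mono_f
  exact (ModuleCat.mono_iff_injective _).1 (mono_map_0_of_mono S.f)

theorem δ_comp_map {S : ShortComplex (Rep.{u} k G)} (hS : S.ShortExact)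
    {S' : ShortComplex (Rep.{u} k Q)} (hS' : S'.ShortExact) (f : G →* Q)
    (τ : S'.map (Rep.resFunctor f) ⟶ S) (n : ℕ) :
    δ hS' n (n + 1) rfl ≫ map f τ.τ₁ (n + 1) = map f τ.τ₃ n ≫ δ hS n (n + 1) rfl := by
  let φ : S'.map (cochainsFunctor k Q) ⟶ S.map (cochainsFunctor k G) :=
    { τ₁ := cochainsMap f τ.τ₁
      τ₂ := cochainsMap f τ.τ₂
      τ₃ := cochainsMap f τ.τ₃
      comm₁₂ := by
        refine (cochainsMap_comp f (MonoidHom.id G) τ.τ₁ S.f).symm.trans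
          (Eq.trans ?_ (cochainsMap_comp (MonoidHom.id Q) f S'.f τ.τ₂))
        exact cochainsMap_congr rfl (congrArg (fun t => t.hom.toLinearMap) τ.comm₁₂)
      comm₂₃ := by
        refine (cochainsMap_comp f (MonoidHom.id G) τ.τ₂ S.g).symm.trans
          (Eq.trans ?_ (cochainsMap_comp (MonoidHom.id Q) f S'.g τ.τ₃))
        exact cochainsMap_congr rfl (congrArg (fun t => t.hom.toLinearMap) τ.comm₂₃) }
  exact HomologicalComplex.HomologySequence.δ_naturality φ (map_cochainsFunctor_shortExact hS')
    (map_cochainsFunctor_shortExact hS) n (n + 1) rfl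

theorem map_comp_map (f : G →* Q) {A A' : Rep.{u} k Q} {B B' : Rep.{u} k G}
    {φ : Rep.res f A ⟶ B} {φ' : Rep.res f A' ⟶ B'} {a : A ⟶ A'} {b : B ⟶ B'}
    (h : (Rep.resFunctor f).map a ≫ φ' = φ ≫ b) (n : ℕ) :
    map (MonoidHom.id Q) a n ≫ map f φ' n = map f φ n ≫ map (MonoidHom.id G) b n :=
  (map_comp (MonoidHom.id Q) f a φ' n).symm.trans
    ((map_congr rfl (congrArg (fun t => t.hom.toLinearMap) h) n).trans
      (map_comp f (MonoidHom.id G) φ b n))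

/-- The inclusion of `H⁰(G, A)` into `A`. -/
noncomputable def H0ι (A : Rep.{u} k G) : groupCohomology A 0 →ₗ[k] A :=
  A.ρ.invariants.subtype ∘ₗ (H0Iso A).hom.hom

theorem H0ι_map (f : G →* Q) {A : Rep.{u} k Q} {B : Rep.{u} k G} (φ : Rep.res f A ⟶ B)
    (x : groupCohomology A 0) : H0ι B ((map f φ 0).hom x) = φ.hom (H0ι A x) :=
  LinearMap.congr_fun (congrArg ModuleCat.Hom.hom (map_H0Iso_hom_f f φ)) x

theorem injective_H0ι (A : Rep.{u} k G) : Function.Injective (H0ι A) :=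
  Subtype.val_injective.comp ((ModuleCat.mono_iff_injective (H0Iso A).hom).1 inferInstance)

theorem H0ι_mem (A : Rep.{u} k G) (x : groupCohomology A 0) (g : G) :
    A.ρ g (H0ι A x) = H0ι A x :=
  ((H0Iso A).hom x).2 g

theorem exists_H0ι_eq (A : Rep.{u} k G) (a : A) (ha : ∀ g, A.ρ g a = a) : ∃ x, H0ι A x = a := by
  obtain ⟨x, hx⟩ := (ModuleCat.epi_iff_surjective (H0Iso A).hom).1 inferInstance ⟨a, ha⟩
  exact ⟨x, congrArg Subtype.val hx⟩

theorem subsingleton_of_iso {A B : Rep.{u} k G} (e : A ≅ B) (n : ℕ)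
    [h : Subsingleton (groupCohomology B n)] : Subsingleton (groupCohomology A n) :=
  have : Subsingleton ((functor k G n).obj B) := h
  ((functor k G n).mapIso e).toLinearEquiv.toEquiv.subsingleton

theorem subsingleton_ihom_of_projective (A M : Rep.{u} k G) [Module.Projective k M.V]
    [Projective M] (n : ℕ) : Subsingleton (groupCohomology ((Rep.ihom M).obj A) (n + 1)) :=
  ModuleCat.subsingleton_of_isZero ((isZero_Ext_succ_of_projective M A n).of_iso
    (TensorResolution.extIso A M (n + 1)).symm)

end groupCohomology

end Homology

/-! ### Acyclic coefficient modules. -/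

namespace GroupPair

noncomputable section

variable {k G Q Λ : Type u} [CommRing k] [Group G] [Group Q]

variable (Q) in
/-- The trivial subgroup, as a family indexed by a point. -/
abbrev botFamily : PUnit.{u + 1} → Subgroup Q := fun _ => ⊥

variable (k Q) in
/-- The regular representation, as the permutation module on the cosets of the trivial subgroup. -/
abbrev regularRep : Rep.{u} k Q := cosetRep k (botFamily Q)

/-- The map `Q → Q/1`. -/
def toBotCosets : Q ≃ Cosets (botFamily Q) :=
  QuotientGroup.quotientBot.toEquiv.symm.trans (Equiv.punitProd _).symm |>.trans
    (Equiv.sigmaEquivProd _ _).symm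

theorem toBotCosets_smul (g q : Q) : toBotCosets (g * q) = g • toBotCosets q := rfl

instance projective_regularRep : Projective (regularRep k Q) := by
  refine Projective.of_iso (P := Rep.leftRegular k Q) (Rep.mkIso (Representation.Equiv.mk
    (MonoidAlgebra.mapDomainLinearEquiv k k toBotCosets) ?_)) inferInstance
  intro g
  refine MonoidAlgebra.lhom_ext' fun x => LinearMap.ext_ring ?_
  simp [toBotCosets_smul]

instance additive_ihom (M : Rep.{u} k G) : (Rep.ihom M).Additive where
  map_add := Rep.hom_ext (Representation.IntertwiningMap.ext (LinearMap.ext fun _ => rfl))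

theorem shortExact_tensorRight {S : ShortComplex (Rep.{u} k G)} (hS : S.ShortExact)
    (M : Rep.{u} k G) [Module.Projective k M.V] : (S.map (tensorRight M)).ShortExact := by
  have := TensorResolution.preservesHomology_tensorLeft M
  have := (tensorLeft M).preservesFiniteLimits_of_preservesHomology
  have := (tensorLeft M).preservesFiniteColimits_of_preservesHomology
  exact ShortComplex.shortExact_of_iso
    (S.mapNatIso (BraidedCategory.tensorLeftIsoTensorRight M)) (hS.map_of_exact (tensorLeft M))

theorem shortExact_ihom {S : ShortComplex (Rep.{u} k G)} (hS : S.ShortExact)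
    (M : Rep.{u} k G) [Module.Projective k M.V] : (S.map (Rep.ihom M)).ShortExact := by
  have : (Rep.ihom M).PreservesEpimorphisms := ⟨fun {X Y} f hf => by
    rw [Rep.epi_iff_surjective] at hf ⊢
    intro φ
    obtain ⟨ψ, hψ⟩ := Module.projective_lifting_property f.hom.toLinearMap
      (show M.V →ₗ[k] Y.V from φ) hf
    exact ⟨(show M.V →ₗ[k] X.V from ψ), hψ⟩⟩
  have : Limits.PreservesLimits (Rep.ihom M) :=
    (ihom.adjunction M).rightAdjoint_preservesLimits
  have := (Rep.ihom M).preservesHomology_of_preservesEpis_and_kernels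
  have := (Rep.ihom M).preservesFiniteLimits_of_preservesHomology
  have := (Rep.ihom M).preservesFiniteColimits_of_preservesHomology
  exact hS.map_of_exact (Rep.ihom M)

/-- The map `A ⊗ M → A ⊗ M'` induced by a `G`-equivariant map from `M` to a `Q`-module `M'`. -/
def tensorMap (f : G →* Q) (A : Rep.{u} k Q) {M : Rep.{u} k G} {M' : Rep.{u} k Q}
    (m : M ⟶ Rep.res f M') : Rep.res f A ⊗ M ⟶ Rep.res f (A ⊗ M') :=
  Rep.ofHom ⟨m.hom.toLinearMap.lTensor A.V, fun g => TensorProduct.ext' fun a v =>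
    congrArg (fun w => A.ρ (f g) a ⊗ₜ[k] w) (Rep.hom_comm_apply m g v)⟩

/-- The map `Hom(M', A) → Hom(M, A)` induced by a `G`-equivariant map from `M` to a `Q`-module
`M'`. -/
def ihomMap (f : G →* Q) (A : Rep.{u} k Q) {M : Rep.{u} k G} {M' : Rep.{u} k Q}
    (m : M ⟶ Rep.res f M') : Rep.res f ((Rep.ihom M').obj A) ⟶ (Rep.ihom M).obj (Rep.res f A) :=
  Rep.ofHom ⟨LinearMap.lcomp k A.V m.hom.toLinearMap, fun g => by
    refine LinearMap.ext fun (φ : M'.V →ₗ[k] A.V) => LinearMap.ext fun v => ?_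
    have := (Rep.hom_comm_apply m g⁻¹ v).symm
    rw [Rep.coe_res_obj_ρ', map_inv] at this
    exact congrArg (fun w => A.ρ (f g) (φ w)) this⟩

/-- Reassociating, the coefficients are A ⊗ (k[Q] ⊗ M) with k[Q] ⊗ M projective over kG. -/
theorem subsingleton_homology (f : G →* Q) (A : Rep.{u} k Q) (M : Rep.{u} k G)
    [Module.Projective k M.V] [Projective (Rep.res f (regularRep k Q) ⊗ M)] (n : ℕ) :
    Subsingleton (groupHomology (Rep.res f (A ⊗ regularRep k Q) ⊗ M) (n + 1)) := by
  have : Module.Projective k (Rep.res f (regularRep k Q)).V := projective_cosetRep _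
  have : Module.Projective k (Rep.res f (regularRep k Q) ⊗ M).V :=
    inferInstanceAs (Module.Projective k (TensorProduct k (Rep.res f (regularRep k Q)).V M.V))
  have := groupHomology.subsingleton_tensor_of_projective (Rep.res f A)
    (Rep.res f (regularRep k Q) ⊗ M) n
  exact groupHomology.subsingleton_of_iso
    (α_ (Rep.res f A) (Rep.res f (regularRep k Q)) M) (n + 1)

/-- `Hom(M, Hom(N, A)) ≅ Hom(M ⊗ N, A)`. -/
def ihomCurryIso (f : G →* Q) (M : Rep.{u} k G) (N A : Rep.{u} k Q) :
    (Rep.ihom M).obj (Rep.res f ((Rep.ihom N).obj A)) ≅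
      (Rep.ihom (M ⊗ Rep.res f N)).obj (Rep.res f A) :=
  Rep.mkIso (Representation.Equiv.mk (TensorProduct.lift.equiv (.id k) M.V N.V A.V) fun g =>
    LinearMap.ext fun (φ : M.V →ₗ[k] N.V →ₗ[k] A.V) => TensorProduct.ext' fun m n => by
      change A.ρ (f g) (φ (M.ρ g⁻¹ m) (N.ρ (f g)⁻¹ n)) =
        A.ρ (f g) (φ (M.ρ g⁻¹ m) (N.ρ (f g⁻¹) n))
      rw [map_inv f])

/-- Currying turns the coefficients into Hom(M ⊗ k[Q], A) with M ⊗ k[Q] projective over kG. -/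
theorem subsingleton_cohomology (f : G →* Q) (A : Rep.{u} k Q) (M : Rep.{u} k G)
    [Module.Projective k M.V] [Projective (Rep.res f (regularRep k Q) ⊗ M)] (n : ℕ) :
    Subsingleton (groupCohomology
      ((Rep.ihom M).obj (Rep.res f ((Rep.ihom (regularRep k Q)).obj A))) (n + 1)) := by
  have : Module.Projective k (Rep.res f (regularRep k Q)).V := projective_cosetRep _
  have : Module.Projective k (M ⊗ Rep.res f (regularRep k Q)).V :=
    inferInstanceAs (Module.Projective k (TensorProduct k M.V (Rep.res f (regularRep k Q)).V))
  have : Projective (M ⊗ Rep.res f (regularRep k Q)) :=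
    Projective.of_iso (β_ (Rep.res f (regularRep k Q)) M) inferInstance
  have := groupCohomology.subsingleton_ihom_of_projective (Rep.res f A)
    (M ⊗ Rep.res f (regularRep k Q)) n
  exact groupCohomology.subsingleton_of_iso
    (ihomCurryIso f M (regularRep k Q) A) (n + 1)

end

end GroupPair

/-! ### Dimension shifting: from degree zero to all degrees. -/

namespace GroupPair

noncomputable section

variable {k G Q Λ : Type u} [CommRing k] [Group G] [Group Q]

section Homology

variable (f : G →* Q) {M : Rep.{u} k G} {M' : Rep.{u} k Q} (m : M ⟶ Rep.res f M')

/-- The morphism `f^*S ⊗ M → S ⊗ M'` of short complexes induced by `m`. -/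
def tensorSeqMap (S : ShortComplex (Rep.{u} k Q)) :
    (S.map (Rep.resFunctor f)).map (tensorRight M) ⟶
      (S.map (tensorRight M')).map (Rep.resFunctor f) where
  τ₁ := tensorMap f S.X₁ m
  τ₂ := tensorMap f S.X₂ m
  τ₃ := tensorMap f S.X₃ m
  comm₁₂ := Rep.hom_ext (Representation.IntertwiningMap.ext
    (TensorProduct.ext' fun _ _ => rfl))
  comm₂₃ := Rep.hom_ext (Representation.IntertwiningMap.ext
    (TensorProduct.ext' fun _ _ => rfl))

/-- The middle term of A ⊗ Δ₁ → A ⊗ k[Q] → A is acyclic for both groups, so degree n + 1 with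
coefficients `A` is the kernel of a map in degree n. The induction runs over all `A` at once because
the step replaces `A` by A ⊗ Δ₁ and A ⊗ k[Q]. -/
theorem bijective_map_tensorMap [Module.Projective k M.V] [Module.Projective k M'.V]
    [Projective (Rep.res f (regularRep k Q) ⊗ M)]
    (h₀ : ∀ A, Function.Bijective (groupHomology.map f (tensorMap f A m) 0).hom) (n : ℕ) :
    ∀ A, Function.Bijective (groupHomology.map f (tensorMap f A m) n).hom := by
  induction n with
  | zero => exact h₀
  | succ n ih =>
    intro A
    -- The sequence of the pair (Q, {1}) serves as a presentation of `A` by the acyclic module A ⊗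
    -- k[Q].
    let S := homologySeq (botFamily Q) A
    have hS : S.ShortExact := homologySeq_shortExact (botFamily Q) A
    have hG := shortExact_tensorRight ((Rep.shortExact_res f).2 hS) M
    have hQ := shortExact_tensorRight hS M'
    have hP : Projective (regularRep k Q ⊗ M') :=
      Projective.of_iso (β_ M' (regularRep k Q))
        (TensorResolution.projective_tensor M' (regularRep k Q))
    have h1 : Subsingleton (groupHomology (Rep.res f (A ⊗ regularRep k Q) ⊗ M) (n + 1)) :=
      subsingleton_homology f A M n
    have h2 : Subsingleton (groupHomology ((A ⊗ regularRep k Q) ⊗ M') (n + 1)) := by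
      -- Acyclicity over `Q` is the case of the identity homomorphism; restriction along it is
      -- definitionally trivial.
      have : Projective (Rep.res (MonoidHom.id Q) (regularRep k Q) ⊗ M') := hP
      exact subsingleton_homology (MonoidHom.id Q) A M' n
    let τ := tensorSeqMap f m S
    refine LinearMap.bijective_of_leftExact
      (groupHomology.exact_δ_map _ hG n) (LinearMap.injective_of_exact (X₁ := groupHomology
        (Rep.res f (A ⊗ regularRep k Q) ⊗ M) (n + 1)) (groupHomology.exact_map_δ _ hG n))
      (groupHomology.exact_δ_map _ hQ n) (LinearMap.injective_of_exact (X₁ := groupHomology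
        ((A ⊗ regularRep k Q) ⊗ M') (n + 1)) (groupHomology.exact_map_δ _ hQ n))
      (a₂ := (groupHomology.map f τ.τ₁ n).hom) (a₃ := (groupHomology.map f τ.τ₂ n).hom)
      ?_ ?_ (ih _) (ih _).1
    · exact congrArg ModuleCat.Hom.hom (groupHomology.δ_comp_map hG hQ f τ n)
    · exact congrArg ModuleCat.Hom.hom (groupHomology.map_comp_map f τ.comm₁₂.symm n)

end Homology

section Cohomology

variable (f : G →* Q) {M : Rep.{u} k G} {M' : Rep.{u} k Q} (m : M ⟶ Rep.res f M')

/-- The morphism `Hom(M', S) → Hom(M, f^*S)` of short complexes induced by `m`. -/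
def ihomSeqMap (S : ShortComplex (Rep.{u} k Q)) :
    (S.map (Rep.ihom M')).map (Rep.resFunctor f) ⟶
      (S.map (Rep.resFunctor f)).map (Rep.ihom M) where
  τ₁ := ihomMap f S.X₁ m
  τ₂ := ihomMap f S.X₂ m
  τ₃ := ihomMap f S.X₃ m
  comm₁₂ := rfl
  comm₂₃ := rfl

/-- Dually, `A` embeds in Hom(k[Q], A), acyclic for both groups, so degree n + 1 is the cokernel of
a map in degree n. -/
theorem bijective_map_ihomMap [Module.Projective k M.V] [Module.Projective k M'.V]
    [Projective (Rep.res f (regularRep k Q) ⊗ M)]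
    (h₀ : ∀ A, Function.Bijective (groupCohomology.map f (ihomMap f A m) 0).hom) (n : ℕ) :
    ∀ A, Function.Bijective (groupCohomology.map f (ihomMap f A m) n).hom := by
  induction n with
  | zero => exact h₀
  | succ n ih =>
    intro A
    let S := cohomologySeq (botFamily Q) A
    have hS : S.ShortExact := cohomologySeq_shortExact (botFamily Q) A
    have hG := shortExact_ihom ((Rep.shortExact_res f).2 hS) M
    have hQ := shortExact_ihom hS M'
    have hP : Projective (regularRep k Q ⊗ M') :=
      Projective.of_iso (β_ M' (regularRep k Q))
        (TensorResolution.projective_tensor M' (regularRep k Q))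
    have h1 : Subsingleton (groupCohomology
        ((Rep.ihom M).obj (Rep.res f ((Rep.ihom (regularRep k Q)).obj A))) (n + 1)) :=
      subsingleton_cohomology f A M n
    have h2 : Subsingleton (groupCohomology
        ((Rep.ihom M').obj ((Rep.ihom (regularRep k Q)).obj A)) (n + 1)) := by
      have : Projective (Rep.res (MonoidHom.id Q) (regularRep k Q) ⊗ M') := hP
      exact subsingleton_cohomology (MonoidHom.id Q) A M' n
    let τ := ihomSeqMap f m S
    refine LinearMap.bijective_of_rightExact
      (groupCohomology.exact_map_δ _ hQ n)
      (LinearMap.surjective_of_exact (X₃ := groupCohomology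
        ((Rep.ihom M').obj ((Rep.ihom (regularRep k Q)).obj A)) (n + 1))
        (groupCohomology.exact_δ_map _ hQ n))
      (groupCohomology.exact_map_δ _ hG n)
      (LinearMap.surjective_of_exact (X₃ := groupCohomology
        ((Rep.ihom M).obj (Rep.res f ((Rep.ihom (regularRep k Q)).obj A))) (n + 1))
        (groupCohomology.exact_δ_map _ hG n))
      (a₁ := (groupCohomology.map f τ.τ₂ n).hom) (a₂ := (groupCohomology.map f τ.τ₃ n).hom)
      ?_ ?_ (ih _).2 (ih _)
    · exact congrArg ModuleCat.Hom.hom (groupCohomology.map_comp_map f τ.comm₂₃.symm n)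
    · exact congrArg ModuleCat.Hom.hom (groupCohomology.δ_comp_map hG hQ f τ n)

end Cohomology
end
end GroupPair

/-! ### Shapiro's lemma for a family of subgroups. -/

namespace GroupPair

noncomputable section

variable {k G Λ : Type u} [CommRing k] [Group G] (H : Λ → Subgroup G) (A : Rep.{u} k G)

section Homology

theorem homologyShapiro_lof [inst : DecidableEq Λ] (n : ℕ) (l : Λ)
    (x : groupHomology (Rep.res (H l).subtype A) n) :
    homologyShapiro H A n (DirectSum.lof k Λ (fun l => groupHomology
      (Rep.res (H l).subtype A) n) l x) =
      (groupHomology.map (H l).subtype (toSummand H A l) n).hom x := by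
  unfold homologyShapiro
  -- `homologyShapiro` was defined with classical decidable equality on `Λ`, so the given instance
  -- is first identified with that one.
  obtain rfl : inst = fun a b => Classical.propDecidable (a = b) :=
    Subsingleton.elim _ _
  classical exact DirectSum.toModule_lof k (M := fun l => groupHomology (Rep.res (H l).subtype A) n) l x

theorem homologyShapiro_comp_lof [DecidableEq Λ] (n : ℕ) (l : Λ) :
    homologyShapiro H A n ∘ₗ DirectSum.lof k Λ (fun l => groupHomology
      (Rep.res (H l).subtype A) n) l =
      (groupHomology.map (H l).subtype (toSummand H A l) n).hom :=
  LinearMap.ext fun x => homologyShapiro_lof H A n l x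

theorem homologyIncl_lof [inst : DecidableEq Λ] (n : ℕ) (l : Λ)
    (x : groupHomology (Rep.res (H l).subtype A) n) :
    homologyIncl H A n (DirectSum.lof k Λ (fun l => groupHomology
      (Rep.res (H l).subtype A) n) l x) =
      (groupHomology.map (H l).subtype (𝟙 (Rep.res (H l).subtype A)) n).hom x := by
  unfold homologyIncl
  obtain rfl : inst = fun a b => Classical.propDecidable (a = b) :=
    Subsingleton.elim _ _
  classical exact DirectSum.toModule_lof k (M := fun l => groupHomology (Rep.res (H l).subtype A) n) l x

/-- The map `a ↦ [g⁻¹ a]` from `A` to `H_0(H_l; A)`, depending on the coset `g H_l`. -/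
def cosetToH0 (l : Λ) (x : G ⧸ H l) :
    A.V →ₗ[k] groupHomology (Rep.res (H l).subtype A) 0 :=
  Quotient.liftOn' x (fun g => (groupHomology.H0π (Rep.res (H l).subtype A)).hom ∘ₗ A.ρ g⁻¹) (by
    intro a b hab
    rw [QuotientGroup.leftRel_apply] at hab
    refine LinearMap.ext fun v => ?_
    change groupHomology.H0π _ _ = groupHomology.H0π _ _
    rw [← sub_eq_zero, ← map_sub, groupHomology.H0π_eq_zero_iff]
    refine Representation.Coinvariants.mem_ker_of_eq (⟨a⁻¹ * b, hab⟩ : H l) (A.ρ b⁻¹ v) _ ?_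
    change A.ρ (a⁻¹ * b) (A.ρ b⁻¹ v) - A.ρ b⁻¹ v = A.ρ a⁻¹ v - A.ρ b⁻¹ v
    rw [← Module.End.mul_apply, ← map_mul, mul_inv_cancel_right])

theorem cosetToH0_mk (l : Λ) (g : G) (v : A.V) :
    cosetToH0 H A l g v = groupHomology.H0π (Rep.res (H l).subtype A) (A.ρ g⁻¹ v) := rfl

theorem cosetToH0_smul (l : Λ) (g : G) (x : G ⧸ H l) (v : A.V) :
    cosetToH0 H A l (g • x) (A.ρ g v) = cosetToH0 H A l x v := by
  induction x using QuotientGroup.induction_on with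
  | H z =>
    rw [MulAction.Quotient.smul_coe, cosetToH0_mk, cosetToH0_mk, smul_eq_mul, ← Module.End.mul_apply, ← map_mul, mul_inv_rev, inv_mul_cancel_right]

/-- A left inverse on coinvariants is a ⊗ [gH_l] ↦ the class of g⁻¹a in H_0(H_l; A). -/
theorem injective_homologyShapiro_zero : Function.Injective (homologyShapiro H A 0) := by
  classical
  let r : TensorProduct k A.V (MonoidAlgebra k (Cosets H)) →ₗ[k] subHomology H A 0 :=
    TensorProduct.lift (((Finsupp.linearCombination k fun x : Cosets H =>
      DirectSum.lof k Λ (fun l => groupHomology (Rep.res (H l).subtype A) 0) x.1 ∘ₗ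
        cosetToH0 H A x.1 x.2) ∘ₗ (MonoidAlgebra.coeffLinearEquiv k).toLinearMap).flip)
  have hr (v : A.V) (x : Cosets H) (c : k) : r (v ⊗ₜ MonoidAlgebra.single x c) =
      c • DirectSum.lof k Λ (fun l => groupHomology (Rep.res (H l).subtype A) 0) x.1
        (cosetToH0 H A x.1 x.2 v) := by
    simp [r]
  obtain ⟨R, hR⟩ := groupHomology.exists_H0_lift (A ⊗ cosetRep k H) r (fun g => by
    refine TensorProduct.ext (LinearMap.ext fun v => MonoidAlgebra.lhom_ext' fun x =>
      LinearMap.ext_ring ?_)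
    change r (A.ρ g v ⊗ₜ Representation.ofMulAction k G (Cosets H) g (MonoidAlgebra.single x 1)) =
      r (v ⊗ₜ MonoidAlgebra.single x 1)
    rw [Representation.ofMulAction_single, hr, hr]
    congr 2
    exact cosetToH0_smul H A x.1 g x.2 v)
  suffices h : R ∘ₗ homologyShapiro H A 0 = LinearMap.id from
    Function.LeftInverse.injective (LinearMap.congr_fun h)
  refine DirectSum.linearMap_ext k fun l => ?_
  rw [LinearMap.comp_assoc, homologyShapiro_comp_lof]
  refine LinearMap.ext fun x => ?_
  obtain ⟨a, rfl⟩ := groupHomology.surjective_H0π _ x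
  change R ((groupHomology.map (H l).subtype (toSummand H A l) 0).hom _) = _
  rw [groupHomology.map_H0π]
  refine (hR _).trans ((hr a ⟨l, (1 : G)⟩ 1).trans ?_)
  rw [one_smul]
  refine (congrArg _ (cosetToH0_mk H A l 1 a)).trans ?_
  rw [inv_one, map_one]
  rfl

/-- In the coinvariants a ⊗ [zH_l] equals z⁻¹a ⊗ [H_l], which comes from the summand `l`. -/
theorem surjective_homologyShapiro_zero : Function.Surjective (homologyShapiro H A 0) := by
  classical
  intro y
  obtain ⟨t, rfl⟩ := groupHomology.surjective_H0π _ y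
  rw [← LinearMap.mem_range]
  change TensorProduct k A.V (MonoidAlgebra k (Cosets H)) at t
  let π : TensorProduct k A.V (MonoidAlgebra k (Cosets H)) →ₗ[k]
    groupHomology (A ⊗ cosetRep k H) 0 := (groupHomology.H0π (A ⊗ cosetRep k H)).hom
  suffices h : ⊤ ≤ (LinearMap.range (homologyShapiro H A 0)).comap π from
    h (Submodule.mem_top (x := t))
  rw [← TensorProduct.span_tmul_eq_top, Submodule.span_le]
  rintro _ ⟨a, v, rfl⟩
  suffices h : ∀ v : MonoidAlgebra k (Cosets H), v ∈ ((LinearMap.range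
      (homologyShapiro H A 0)).comap π).comap (TensorProduct.mk k A.V _ a) from h v
  intro v
  induction v using MonoidAlgebra.induction_linear with
  | zero => exact zero_mem _
  | add f g hf hg => exact add_mem hf hg
  | single x c =>
    obtain ⟨l, x⟩ := x
    induction x using QuotientGroup.induction_on with
    | H z =>
      refine ⟨DirectSum.lof k Λ (fun l => groupHomology (Rep.res (H l).subtype A) 0) l
        (groupHomology.H0π (Rep.res (H l).subtype A) (c • A.ρ z⁻¹ a)), ?_⟩
      rw [homologyShapiro_lof, groupHomology.map_H0π]
      change π _ = π _
      rw [← sub_eq_zero, ← map_sub]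
      refine (groupHomology.H0π_eq_zero_iff _ _).2
        (Representation.Coinvariants.mem_ker_of_eq z⁻¹
          (a ⊗ₜ[k] (MonoidAlgebra.single (⟨l, z⟩ : Cosets H) c)) _ ?_)
      change A.ρ z⁻¹ a ⊗ₜ[k] Representation.ofMulAction k G (Cosets H) z⁻¹
        (MonoidAlgebra.single _ c) - _ = (c • A.ρ z⁻¹ a) ⊗ₜ[k] _ - _
      rw [Representation.ofMulAction_single, TensorProduct.smul_tmul, MonoidAlgebra.smul_single]
      congr 4
      · exact congrArg (fun x : G => (⟨l, (x : G ⧸ H l)⟩ : Cosets H)) (inv_mul_cancel z)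
      · simp

theorem homologyShapiro_naturality {A B : Rep.{u} k G} (φ : A ⟶ B) (n : ℕ) :
    homologyShapiro H B n ∘ₗ DirectSum.lmap (fun l => (groupHomology.map (MonoidHom.id (H l))
        ((Rep.resFunctor (H l).subtype).map φ) n).hom) =
      (groupHomology.map (MonoidHom.id G) (φ ▷ cosetRep k H) n).hom ∘ₗ homologyShapiro H A n := by
  classical
  refine DirectSum.linearMap_ext k fun l => ?_
  rw [LinearMap.comp_assoc, LinearMap.comp_assoc, homologyShapiro_comp_lof]
  refine LinearMap.ext fun x => ?_
  rw [LinearMap.comp_apply, LinearMap.comp_apply, DirectSum.lmap_lof, homologyShapiro_lof]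
  exact LinearMap.congr_fun (congrArg ModuleCat.Hom.hom
    (groupHomology.map_comp_map (H l).subtype (φ := toSummand H A l) (φ' := toSummand H B l)
      (a := (Rep.resFunctor (H l).subtype).map φ) (b := φ ▷ cosetRep k H) rfl n)) x

/-- The morphism `S → S ⊗ (⊕_λ k[G/H_λ])` of short complexes of `H_λ`-modules. -/
def toSummandSeqMap (S : ShortComplex (Rep.{u} k G)) (l : Λ) :
    S.map (Rep.resFunctor (H l).subtype) ⟶
      (S.map (tensorRight (cosetRep k H))).map (Rep.resFunctor (H l).subtype) where
  τ₁ := toSummand H S.X₁ l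
  τ₂ := toSummand H S.X₂ l
  τ₃ := toSummand H S.X₃ l
  comm₁₂ := rfl
  comm₂₃ := rfl

/-- Dimension shifting along A ⊗ Δ₁ → A ⊗ k[G] → A. The middle term stays acyclic over each H_l
because restriction to a subgroup preserves projectives. -/
theorem bijective_homologyShapiro (n : ℕ) :
    ∀ A : Rep.{u} k G, Function.Bijective (homologyShapiro H A n) := by
  classical
  induction n with
  | zero => exact fun A => ⟨injective_homologyShapiro_zero H A, surjective_homologyShapiro_zero H A⟩
  | succ n ih =>
    intro A
    let S := homologySeq (botFamily G) A
    have hS : S.ShortExact := homologySeq_shortExact (botFamily G) A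
    have hH (l) := (Rep.shortExact_res (H l).subtype).2 hS
    have hG := shortExact_tensorRight hS (cosetRep k H)
    have h1 (l) : Subsingleton (groupHomology
        (Rep.res (H l).subtype (A ⊗ regularRep k G)) (n + 1)) := by
      have : Module.Projective k (Rep.res (H l).subtype (regularRep k G)).V :=
        projective_cosetRep _
      have : Projective (Rep.res (H l).subtype (regularRep k G)) :=
        (Rep.resFunctor (H l).subtype).projective_obj (regularRep k G)
      exact groupHomology.subsingleton_tensor_of_projective (Rep.res (H l).subtype A)
        (Rep.res (H l).subtype (regularRep k G)) n
    have h1' : Subsingleton (subHomology H (A ⊗ regularRep k G) (n + 1)) :=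
      ⟨fun x y => DirectSum.ext_component k fun l => Subsingleton.elim _ _⟩
    have h2 : Subsingleton (groupHomology ((A ⊗ regularRep k G) ⊗ cosetRep k H) (n + 1)) := by
      have : Projective (Rep.res (MonoidHom.id G) (regularRep k G) ⊗ cosetRep k H) :=
        Projective.of_iso (β_ (cosetRep k H) (regularRep k G))
          (TensorResolution.projective_tensor (cosetRep k H) (regularRep k G))
      exact subsingleton_homology (MonoidHom.id G) A (cosetRep k H) n
    refine LinearMap.bijective_of_leftExact
      (DirectSum.exact_lmap fun l => groupHomology.exact_δ_map _ (hH l) n)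
      (LinearMap.injective_of_exact (X₁ := subHomology H (A ⊗ regularRep k G) (n + 1))
        (DirectSum.exact_lmap fun l => groupHomology.exact_map_δ _ (hH l) n))
      (groupHomology.exact_δ_map _ hG n) (LinearMap.injective_of_exact (X₁ := groupHomology
        ((A ⊗ regularRep k G) ⊗ cosetRep k H) (n + 1)) (groupHomology.exact_map_δ _ hG n))
      (a₂ := homologyShapiro H S.X₁ n) (a₃ := homologyShapiro H S.X₂ n)
      ?_ ?_ (ih _) (ih _).1
    · refine DirectSum.linearMap_ext k fun l => LinearMap.ext fun x => ?_
      refine (congrArg (homologyShapiro H S.X₁ n) (DirectSum.lmap_lof (R := k)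
        (fun l => (groupHomology.δ (hH l) (n + 1) n rfl).hom) l x)).trans ?_
      refine (homologyShapiro_lof H S.X₁ n l _).trans (Eq.trans ?_ (congrArg
        (groupHomology.δ hG (n + 1) n rfl).hom (homologyShapiro_lof H A (n + 1) l x).symm))
      exact LinearMap.congr_fun (congrArg ModuleCat.Hom.hom
        (groupHomology.δ_comp_map (hH l) hG (H l).subtype (toSummandSeqMap H S l) n)) x
    · exact homologyShapiro_naturality H S.f n

end Homology

section Cohomology

theorem H0ι_cohomologyShapiro (x : groupCohomology ((Rep.ihom (cosetRep k H)).obj A) 0) (l : Λ) :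
    groupCohomology.H0ι (Rep.res (H l).subtype A) (cohomologyShapiro H A 0 x l) =
      (show MonoidAlgebra k (Cosets H) →ₗ[k] A.V from groupCohomology.H0ι _ x)
        (MonoidAlgebra.single (⟨l, (1 : G)⟩ : Cosets H) 1) :=
  groupCohomology.H0ι_map (H l).subtype (evalSummand H A l) x

/-- An equivariant map on ⊕ k[G/H_l] is determined by its values at the base cosets. -/
theorem injective_cohomologyShapiro_zero : Function.Injective (cohomologyShapiro H A 0) := by
  rw [injective_iff_map_eq_zero]
  intro x hx
  refine groupCohomology.injective_H0ι _ ?_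
  rw [map_zero]
  have hinv := groupCohomology.H0ι_mem _ x
  have hev := H0ι_cohomologyShapiro H A x
  generalize groupCohomology.H0ι _ x = φ at hinv hev
  change MonoidAlgebra k (Cosets H) →ₗ[k] A.V at φ
  refine MonoidAlgebra.lhom_ext' fun y => LinearMap.ext_ring ?_
  obtain ⟨l, y⟩ := y
  induction y using QuotientGroup.induction_on with
  | H z =>
    have h1 : A.ρ z (φ (Representation.ofMulAction k G (Cosets H) z⁻¹
      (MonoidAlgebra.single (⟨l, z⟩ : Cosets H) 1))) = φ (MonoidAlgebra.single ⟨l, z⟩ 1) :=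
        LinearMap.congr_fun (hinv z) _
    have h2 : z⁻¹ • (⟨l, z⟩ : Cosets H) = ⟨l, (1 : G)⟩ :=
      congrArg (fun x : G => (⟨l, (x : G ⧸ H l)⟩ : Cosets H)) (inv_mul_cancel z)
    have h3 : φ (MonoidAlgebra.single (⟨l, (1 : G)⟩ : Cosets H) 1) = 0 := by
      refine (hev l).symm.trans ?_
      rw [hx]
      exact map_zero _
    rw [Representation.ofMulAction_single, h2, h3, map_zero] at h1
    exact h1.symm

/-- The map sending the coset `g H_l` to `g a`, for an `H_l`-invariant element `a`. -/
def cosetOrbit (l : Λ) (a : A.V) (ha : ∀ h ∈ H l, A.ρ h a = a) (x : G ⧸ H l) : A.V :=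
  Quotient.liftOn' x (fun g => A.ρ g a) (by
    intro x y hxy
    rw [QuotientGroup.leftRel_apply] at hxy
    rw [← ha _ hxy, ← Module.End.mul_apply, ← map_mul, mul_inv_cancel_left, ha _ hxy])

theorem cosetOrbit_smul (l : Λ) (a : A.V) (ha : ∀ h ∈ H l, A.ρ h a = a) (g : G) (x : G ⧸ H l) :
    cosetOrbit H A l a ha (g • x) = A.ρ g (cosetOrbit H A l a ha x) := by
  induction x using QuotientGroup.induction_on with
  | H z =>
    change A.ρ (g * z) a = A.ρ g (A.ρ z a)
    rw [map_mul, Module.End.mul_apply]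

/-- H_l-invariant elements a_l extend to the equivariant map [gH_l] ↦ g a_l. -/
theorem surjective_cohomologyShapiro_zero : Function.Surjective (cohomologyShapiro H A 0) := by
  intro y
  let a (l : Λ) : A.V := groupCohomology.H0ι (Rep.res (H l).subtype A) (y l)
  have ha (l : Λ) (h : G) (hh : h ∈ H l) : A.ρ h (a l) = a l :=
    groupCohomology.H0ι_mem _ (y l) ⟨h, hh⟩
  let φ : MonoidAlgebra k (Cosets H) →ₗ[k] A.V :=
    (Finsupp.linearCombination k fun x : Cosets H => cosetOrbit H A x.1 (a x.1) (ha x.1) x.2) ∘ₗ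
      (MonoidAlgebra.coeffLinearEquiv k).toLinearMap
  have hφ (x : Cosets H) :
      φ (MonoidAlgebra.single x 1) = cosetOrbit H A x.1 (a x.1) (ha x.1) x.2 := by
    simp [φ]
  obtain ⟨x, hx⟩ := groupCohomology.exists_H0ι_eq ((Rep.ihom (cosetRep k H)).obj A) φ (by
    intro g
    refine MonoidAlgebra.lhom_ext' fun x => LinearMap.ext_ring ?_
    change A.ρ g (φ (Representation.ofMulAction k G (Cosets H) g⁻¹
      (MonoidAlgebra.single x 1))) = φ (MonoidAlgebra.single x 1)
    rw [Representation.ofMulAction_single, hφ, hφ]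
    refine (cosetOrbit_smul H A _ _ _ _ _).symm.trans ?_
    change cosetOrbit H A x.1 (a x.1) (ha x.1) (g • g⁻¹ • x.2) = _
    rw [smul_inv_smul])
  refine ⟨x, funext fun l => groupCohomology.injective_H0ι _ ?_⟩
  refine (H0ι_cohomologyShapiro H A x l).trans ?_
  rw [hx]
  refine (hφ _).trans ?_
  change A.ρ 1 (a l) = a l
  rw [map_one, Module.End.one_apply]

theorem cohomologyShapiro_naturality {A B : Rep.{u} k G} (φ : A ⟶ B) (n : ℕ) :
    cohomologyShapiro H B n ∘ₗ
        (groupCohomology.map (MonoidHom.id G) ((Rep.ihom (cosetRep k H)).map φ) n).hom =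
      LinearMap.pi (fun l => (groupCohomology.map (MonoidHom.id (H l))
        ((Rep.resFunctor (H l).subtype).map φ) n).hom ∘ₗ LinearMap.proj l) ∘ₗ
          cohomologyShapiro H A n := by
  refine LinearMap.ext fun x => funext fun l => ?_
  exact LinearMap.congr_fun (congrArg ModuleCat.Hom.hom
    (groupCohomology.map_comp_map (H l).subtype (φ := evalSummand H A l) (φ' := evalSummand H B l)
      (a := (Rep.ihom (cosetRep k H)).map φ)
      (b := (Rep.resFunctor (H l).subtype).map φ) rfl n)) x

/-- The morphism `Hom(⊕_λ k[G/H_λ], S) → S` of short complexes of `H_λ`-modules. -/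
def evalSummandSeqMap (S : ShortComplex (Rep.{u} k G)) (l : Λ) :
    (S.map (Rep.ihom (cosetRep k H))).map (Rep.resFunctor (H l).subtype) ⟶
      S.map (Rep.resFunctor (H l).subtype) where
  τ₁ := evalSummand H S.X₁ l
  τ₂ := evalSummand H S.X₂ l
  τ₃ := evalSummand H S.X₃ l
  comm₁₂ := rfl
  comm₂₃ := rfl

/-- Dimension shifting along A → Hom(k[G], A) → Hom(Δ₁, A), whose middle term is acyclic over `G`
with values in Hom(⊕ k[G/H_l], –) and over each H_l. -/
theorem bijective_cohomologyShapiro (n : ℕ) :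
    ∀ A : Rep.{u} k G, Function.Bijective (cohomologyShapiro H A n) := by
  induction n with
  | zero =>
    exact fun A => ⟨injective_cohomologyShapiro_zero H A, surjective_cohomologyShapiro_zero H A⟩
  | succ n ih =>
    intro A
    let S := cohomologySeq (botFamily G) A
    have hS : S.ShortExact := cohomologySeq_shortExact (botFamily G) A
    have hH (l) := (Rep.shortExact_res (H l).subtype).2 hS
    have hG := shortExact_ihom hS (cosetRep k H)
    have h1 (l) : Subsingleton (groupCohomology
        (Rep.res (H l).subtype ((Rep.ihom (regularRep k G)).obj A)) (n + 1)) := by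
      have : Module.Projective k (Rep.res (H l).subtype (regularRep k G)).V :=
        projective_cosetRep _
      have : Projective (Rep.res (H l).subtype (regularRep k G)) :=
        (Rep.resFunctor (H l).subtype).projective_obj (regularRep k G)
      exact groupCohomology.subsingleton_ihom_of_projective (Rep.res (H l).subtype A)
        (Rep.res (H l).subtype (regularRep k G)) n
    have h1' : Subsingleton (subCohomology H ((Rep.ihom (regularRep k G)).obj A) (n + 1)) :=
      ⟨fun x y => funext fun l => Subsingleton.elim _ _⟩
    have h2 : Subsingleton (groupCohomology
        ((Rep.ihom (cosetRep k H)).obj ((Rep.ihom (regularRep k G)).obj A)) (n + 1)) := by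
      have : Projective (Rep.res (MonoidHom.id G) (regularRep k G) ⊗ cosetRep k H) :=
        Projective.of_iso (β_ (cosetRep k H) (regularRep k G))
          (TensorResolution.projective_tensor (cosetRep k H) (regularRep k G))
      exact subsingleton_cohomology (MonoidHom.id G) A (cosetRep k H) n
    refine LinearMap.bijective_of_rightExact
      (groupCohomology.exact_map_δ _ hG n)
      (LinearMap.surjective_of_exact (X₃ := groupCohomology
        ((Rep.ihom (cosetRep k H)).obj ((Rep.ihom (regularRep k G)).obj A)) (n + 1))
        (groupCohomology.exact_δ_map _ hG n))
      (LinearMap.exact_pi fun l => groupCohomology.exact_map_δ _ (hH l) n)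
      (LinearMap.surjective_of_exact (X₃ := subCohomology H
        ((Rep.ihom (regularRep k G)).obj A) (n + 1))
        (LinearMap.exact_pi fun l => groupCohomology.exact_δ_map _ (hH l) n))
      (a₁ := cohomologyShapiro H S.X₂ n) (a₂ := cohomologyShapiro H S.X₃ n)
      ?_ ?_ (ih _).2 (ih _)
    · exact cohomologyShapiro_naturality H S.g n
    · refine LinearMap.ext fun x => funext fun l => ?_
      exact LinearMap.congr_fun (congrArg ModuleCat.Hom.hom
        (groupCohomology.δ_comp_map (hH l) hG (H l).subtype (evalSummandSeqMap H S l) n)) x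

end Cohomology

end
end GroupPair

/-! ### The long exact sequences of a pair. -/

namespace GroupPair

noncomputable section

variable {k G Λ : Type u} [CommRing k] [Group G] (H : Λ → Subgroup G) (A : Rep.{u} k G)

section Homology

/-- Shapiro's isomorphism `⊕_λ H_n(H_λ; A) ≅ H_n(G; A ⊗ (⊕_λ k[G/H_λ]))`. -/
def homologyShapiroEquiv (n : ℕ) :
    subHomology H A n ≃ₗ[k] groupHomology (A ⊗ cosetRep k H) n :=
  LinearEquiv.ofBijective (homologyShapiro H A n) (bijective_homologyShapiro H n A)

/-- The boundary map `H_{n+1}(G, {H_λ}; A) → ⊕_λ H_n(H_λ; A)`. -/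
def homologyBoundary (n : ℕ) : relHomology H A (n + 1) →ₗ[k] subHomology H A n :=
  (homologyShapiroEquiv H A n).symm.toLinearMap ∘ₗ relToCoset H A n

theorem isHomologyBoundary_homologyBoundary (n : ℕ) :
    IsHomologyBoundary H A n (homologyBoundary H A n) :=
  LinearMap.ext fun _ => (homologyShapiroEquiv H A n).apply_symm_apply _

/-- The augmentation of the base coset is 1, so a ↦ a ⊗ [H_l] ↦ a is the identity. This identifies
the map to H_n(G; A) in the coefficient sequence with the one induced by the inclusions. -/
theorem homologyIncl_eq (n : ℕ) :
    homologyIncl H A n =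
      (groupHomology.map (MonoidHom.id G) (augTensor H A) n).hom ∘ₗ homologyShapiro H A n := by
  classical
  refine DirectSum.linearMap_ext k fun l => LinearMap.ext fun x => ?_
  rw [LinearMap.comp_apply, homologyIncl_lof, LinearMap.comp_apply, LinearMap.comp_apply,
    homologyShapiro_lof]
  refine LinearMap.congr_fun (congrArg ModuleCat.Hom.hom (Eq.trans ?_
    (groupHomology.map_comp (H l).subtype (MonoidHom.id G) (toSummand H A l)
      (augTensor H A) n))) x
  refine groupHomology.map_congr rfl (LinearMap.ext fun a => ?_) n
  change a = augLin k H (MonoidAlgebra.single _ 1) • a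
  simp

theorem surjective_homologyIncl_zero [Nonempty Λ] : Function.Surjective (homologyIncl H A 0) := by
  rw [homologyIncl_eq]
  exact (groupHomology.surjective_map_zero _ (homologySeq_shortExact H A)).comp
    (bijective_homologyShapiro H 0 A).2

theorem isLongExactHomology [Nonempty Λ] :
    IsLongExactHomology (homologyIncl H A) (homologyToRel H A) (homologyBoundary H A) := by
  have hS := homologySeq_shortExact H A
  let r (n) : relHomology H A (n + 1) ≃ₗ[k] groupHomology (A ⊗ relModule k H) n :=
    (relHomologyIso H A n).toLinearEquiv
  have hI (n) : (groupHomology.map (MonoidHom.id G) (augTensor H A) n).hom ∘ₗ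
      (homologyShapiroEquiv H A n).toLinearMap = homologyIncl H A n := (homologyIncl_eq H A n).symm
  have hJ (n) : (groupHomology.δ hS (n + 1) n rfl).hom =
      (r n).toLinearMap ∘ₗ homologyToRel H A (n + 1) :=
    LinearMap.ext fun x => ((r n).apply_symm_apply _).symm
  have hD (n) : (groupHomology.map (MonoidHom.id G) (homologySeq H A).f n).hom ∘ₗ
      (r n).toLinearMap = (homologyShapiroEquiv H A n).toLinearMap ∘ₗ homologyBoundary H A n :=
    (isHomologyBoundary_homologyBoundary H A n).symm
  refine ⟨fun n => ?_, fun n => ?_, fun n => ?_, fun x => ⟨0, Subsingleton.elim (α := PUnit) _ _⟩⟩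
  · cases n with
    | zero =>
      -- The relative group in degree 0 is zero by convention, so exactness here means surjectivity
      -- on H_0.
      exact fun y => ⟨fun _ => surjective_homologyIncl_zero H A y, fun _ => rfl⟩
    | succ n =>
      exact (Function.Exact.iff_of_ladder_linearEquiv (e₁ := homologyShapiroEquiv H A (n + 1))
        (e₂ := LinearEquiv.refl k _) (e₃ := r n) (hI (n + 1)) (hJ n)).1
          (groupHomology.exact_map_δ _ hS n)
  · exact (Function.Exact.iff_of_ladder_linearEquiv (e₁ := LinearEquiv.refl k _)
      (e₂ := r n) (e₃ := homologyShapiroEquiv H A n) (hJ n) (hD n)).1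
        (groupHomology.exact_δ_map _ hS n)
  · exact (Function.Exact.iff_of_ladder_linearEquiv (e₁ := r n)
      (e₂ := homologyShapiroEquiv H A n) (e₃ := LinearEquiv.refl k _) (hD n) (hI n)).1
        (groupHomology.exact_map_map _ hS n)

end Homology

section Cohomology

/-- Shapiro's isomorphism `H^n(G; Hom(⊕_λ k[G/H_λ], A)) ≅ ∏_λ H^n(H_λ; A)`. -/
def cohomologyShapiroEquiv (n : ℕ) :
    groupCohomology ((Rep.ihom (cosetRep k H)).obj A) n ≃ₗ[k] subCohomology H A n :=
  LinearEquiv.ofBijective (cohomologyShapiro H A n) (bijective_cohomologyShapiro H n A)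

/-- The coboundary map `∏_λ H^n(H_λ; A) → H^{n+1}(G, {H_λ}; A)`. -/
def cohomologyCoboundary (n : ℕ) : subCohomology H A n →ₗ[k] relCohomology H A (n + 1) :=
  cosetToRel H A n ∘ₗ (cohomologyShapiroEquiv H A n).symm.toLinearMap

theorem isCohomologyCoboundary_cohomologyCoboundary (n : ℕ) :
    IsCohomologyCoboundary H A n (cohomologyCoboundary H A n) :=
  LinearMap.ext fun x =>
    congrArg (cosetToRel H A n) ((cohomologyShapiroEquiv H A n).symm_apply_apply x)

/-- Evaluating v ↦ ε(v)a at a base coset returns a. -/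
theorem cohomologyRestr_eq (n : ℕ) :
    cohomologyRestr H A n =
      cohomologyShapiro H A n ∘ₗ (groupCohomology.map (MonoidHom.id G) (coaug H A) n).hom := by
  refine LinearMap.ext fun x => funext fun l => ?_
  refine LinearMap.congr_fun (congrArg ModuleCat.Hom.hom (Eq.trans ?_
    (groupCohomology.map_comp (MonoidHom.id G) (H l).subtype (coaug H A)
      (evalSummand H A l) n))) x
  refine groupCohomology.map_congr rfl (LinearMap.ext fun a => ?_) n
  change a = augLin k H (MonoidAlgebra.single _ 1) • a
  simp

theorem injective_cohomologyRestr_zero [Nonempty Λ] :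
    Function.Injective (cohomologyRestr H A 0) := by
  have h : Function.Injective (groupCohomology.map (MonoidHom.id G) (coaug H A) 0).hom :=
    groupCohomology.injective_map_zero (cohomologySeq H A) (cohomologySeq_shortExact H A)
  rw [cohomologyRestr_eq, LinearMap.coe_comp]
  exact (bijective_cohomologyShapiro H 0 A).1.comp h

theorem isLongExactCohomology [Nonempty Λ] :
    IsLongExactCohomology (cohomologyRestr H A) (relToCohomology H A)
      (cohomologyCoboundary H A) := by
  have hS := cohomologySeq_shortExact H A
  let r (n) : groupCohomology ((Rep.ihom (relModule k H)).obj A) n ≃ₗ[k]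
    relCohomology H A (n + 1) := (relCohomologyIso H A n).symm.toLinearEquiv
  have hI (n) : cohomologyRestr H A n = (cohomologyShapiroEquiv H A n).toLinearMap ∘ₗ
      (groupCohomology.map (MonoidHom.id G) (coaug H A) n).hom := cohomologyRestr_eq H A n
  have hJ (n) : relToCohomology H A (n + 1) ∘ₗ (r n).toLinearMap =
      (groupCohomology.δ hS n (n + 1) rfl).hom :=
    congrArg ModuleCat.Hom.hom ((relCohomologyIso H A n).inv_hom_id_assoc
      (groupCohomology.δ hS n (n + 1) rfl))
  have hD (n) : cohomologyCoboundary H A n ∘ₗ (cohomologyShapiroEquiv H A n).toLinearMap =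
      (r n).toLinearMap ∘ₗ
        (groupCohomology.map (MonoidHom.id G) (cohomologySeq H A).g n).hom :=
    isCohomologyCoboundary_cohomologyCoboundary H A n
  refine ⟨fun x y _ => Subsingleton.elim (α := PUnit) _ _, fun n => ?_, fun n => ?_, fun n => ?_⟩
  · cases n with
    | zero =>
      -- As the relative group in degree 0 is zero, exactness here means injectivity of restriction
      -- on H⁰.
      refine fun y => ⟨fun hy => ⟨0, ?_⟩, ?_⟩
      · rw [map_zero]
        exact (injective_cohomologyRestr_zero H A (hy.trans (map_zero _).symm)).symm
      · rintro ⟨x, rfl⟩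
        exact map_zero _
    | succ n =>
      exact (Function.Exact.iff_of_ladder_linearEquiv (e₁ := r n)
        (e₂ := LinearEquiv.refl k _) (e₃ := cohomologyShapiroEquiv H A (n + 1)) (hJ n)
          (hI (n + 1))).2 (groupCohomology.exact_δ_map _ hS n)
  · exact (Function.Exact.iff_of_ladder_linearEquiv (e₁ := LinearEquiv.refl k _)
      (e₂ := cohomologyShapiroEquiv H A n) (e₃ := r n) (hI n) (hD n)).2
        (groupCohomology.exact_map_map _ hS n)
  · exact (Function.Exact.iff_of_ladder_linearEquiv (e₁ := cohomologyShapiroEquiv H A n)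
      (e₂ := r n) (e₃ := LinearEquiv.refl k _) (hD n) (hJ n)).2
        (groupCohomology.exact_map_δ _ hS n)

end Cohomology

end
end GroupPair

/-! ### Naturality of the long exact sequences under a map of pairs. -/

theorem CategoryTheory.Iso.comp_inv_comp_conj {C : Type*} [Category C] {X X' Y Y' Z Z' : C}
    (e : Z ≅ Y) (e' : Z' ≅ Y') {d : X ⟶ Y} {d' : X' ⟶ Y'} {m₀ : X ⟶ X'} {m : Y ⟶ Y'}
    (h : d ≫ m = m₀ ≫ d') :
    (d ≫ e.inv) ≫ e.hom ≫ m ≫ e'.inv = m₀ ≫ d' ≫ e'.inv := by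
  rw [Category.assoc, Iso.inv_hom_id_assoc, ← Category.assoc, h, Category.assoc]

theorem CategoryTheory.Iso.conj_comp_hom_comp {C : Type*} [Category C] {X X' Y Y' Z Z' : C}
    (e : Z ≅ Y) (e' : Z' ≅ Y') {g : Y ⟶ X} {g' : Y' ⟶ X'} {m₀ : X ⟶ X'} {m : Y ⟶ Y'}
    (h : g ≫ m₀ = m ≫ g') :
    (e.hom ≫ m ≫ e'.inv) ≫ e'.hom ≫ g' = (e.hom ≫ g) ≫ m₀ := by
  rw [Category.assoc, Category.assoc, Iso.inv_hom_id_assoc, ← h, Category.assoc]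

namespace GroupPair

noncomputable section

variable {k G Q Λ : Type u} [CommRing k] [Group G] [Group Q] {H : Λ → Subgroup G}
  {K : Λ → Subgroup Q} (f : G →* Q) (hf : ∀ l, H l ≤ (K l).comap f) (A : Rep.{u} k Q)

variable (k) in
/-- The map `⊕_λ k[G/H_λ] → ⊕_λ k[Q/K_λ]` of `G`-modules. -/
def cosetRepMap : cosetRep k H ⟶ Rep.res f (cosetRep k K) :=
  Rep.ofHom ⟨cosetLin k f hf, fun g => LinearMap.ext fun v => cosetLin_ρ f hf g v⟩

section Homology

/-- The map from the sequence `A ⊗ Δ_G → A ⊗ (⊕_λ k[G/H_λ]) → A` to its analogue for `Q`. -/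
def homologySeqMap : homologySeq H (Rep.res f A) ⟶ (homologySeq K A).map (Rep.resFunctor f) where
  τ₁ := relTensorMap f hf A
  τ₂ := tensorMap f A (cosetRepMap k f hf)
  τ₃ := 𝟙 _
  comm₁₂ := Rep.hom_ext (Representation.IntertwiningMap.ext
    (TensorProduct.ext' fun _ _ => rfl))
  comm₂₃ := Rep.hom_ext (Representation.IntertwiningMap.ext
    (TensorProduct.ext' fun a v => congrArg (fun c : k => c • a) (augLin_cosetLin f hf v)))

theorem subHomologyMap_lof [DecidableEq Λ] (n : ℕ) (l : Λ)
    (x : groupHomology (Rep.res (H l).subtype (Rep.res f A)) n) :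
    subHomologyMap f hf A n (DirectSum.lof k Λ (fun l => groupHomology
      (Rep.res (H l).subtype (Rep.res f A)) n) l x) =
      DirectSum.lof k Λ (fun l => groupHomology (Rep.res (K l).subtype A) n) l
        ((groupHomology.map (A := Rep.res (H l).subtype (Rep.res f A))
          (B := Rep.res (K l).subtype A) (subMap f hf l) (𝟙 _) n).hom x) :=
  DirectSum.lmap_lof (R := k) (fun l => (groupHomology.map
    (A := Rep.res (H l).subtype (Rep.res f A))
      (B := Rep.res (K l).subtype A) (subMap f hf l) (𝟙 _) n).hom) l x

theorem homologyMap_comp_homologyIncl (n : ℕ) :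
    homologyMap f A n ∘ₗ homologyIncl H (Rep.res f A) n =
      homologyIncl K A n ∘ₗ subHomologyMap f hf A n := by
  classical
  refine DirectSum.linearMap_ext k fun l => LinearMap.ext fun x => ?_
  refine (congrArg (homologyMap f A n) (homologyIncl_lof H (Rep.res f A) n l x)).trans
    (Eq.trans ?_ (congrArg (homologyIncl K A n) (subHomologyMap_lof f hf A n l x)).symm)
  refine Eq.trans ?_ (homologyIncl_lof K A n l _).symm
  exact LinearMap.congr_fun (congrArg ModuleCat.Hom.hom
    ((groupHomology.map_comp (H l).subtype f (𝟙 (Rep.res (H l).subtype (Rep.res f A)))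
      (𝟙 (Rep.res f A)) n).symm.trans ((groupHomology.map_congr rfl rfl n).trans
        (groupHomology.map_comp (A := Rep.res (H l).subtype (Rep.res f A))
          (B := Rep.res (K l).subtype A) (subMap f hf l) (K l).subtype (𝟙 _) (𝟙 _) n)))) x

theorem relHomologyMap_comp_homologyToRel [Nonempty Λ] (n : ℕ) :
    relHomologyMap f hf A n ∘ₗ homologyToRel H (Rep.res f A) n =
      homologyToRel K A n ∘ₗ homologyMap f A n := by
  cases n with
  | zero => exact LinearMap.ext fun x => Subsingleton.elim (α := PUnit) _ _
  | succ n =>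
    have h := groupHomology.δ_comp_map (homologySeq_shortExact H (Rep.res f A))
      (homologySeq_shortExact K A) f (homologySeqMap f hf A) n
    exact congrArg ModuleCat.Hom.hom (Iso.comp_inv_comp_conj
      (relHomologyIso H (Rep.res f A) n) (relHomologyIso K A n) h)

/-- The map of cosets sends the base coset H_l to the base coset K_l, so the two composites already
agree on coefficients. -/
theorem map_comp_homologyShapiro (n : ℕ) :
    (groupHomology.map f (tensorMap f A (cosetRepMap k f hf)) n).hom ∘ₗ
        homologyShapiro H (Rep.res f A) n =
      homologyShapiro K A n ∘ₗ subHomologyMap f hf A n := by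
  classical
  refine DirectSum.linearMap_ext k fun l => LinearMap.ext fun x => ?_
  refine (congrArg (groupHomology.map f (tensorMap f A (cosetRepMap k f hf)) n).hom
    (homologyShapiro_lof H (Rep.res f A) n l x)).trans
    (Eq.trans ?_ (congrArg (homologyShapiro K A n) (subHomologyMap_lof f hf A n l x)).symm)
  refine Eq.trans ?_ (homologyShapiro_lof K A n l _).symm
  refine LinearMap.congr_fun (congrArg ModuleCat.Hom.hom
    ((groupHomology.map_comp (H l).subtype f (toSummand H (Rep.res f A) l)
      (tensorMap f A (cosetRepMap k f hf)) n).symm.trans ((groupHomology.map_congr rfl ?_ n).trans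
        (groupHomology.map_comp (A := Rep.res (H l).subtype (Rep.res f A))
          (B := Rep.res (K l).subtype A) (subMap f hf l) (K l).subtype (𝟙 _)
            (toSummand K A l) n)))) x
  refine LinearMap.ext fun a => ?_
  change a ⊗ₜ[k] cosetLin k f hf (MonoidAlgebra.single _ 1) = a ⊗ₜ[k] MonoidAlgebra.single _ 1
  rw [cosetLin_single]
  congr 2
  exact congrArg (fun q : Q => (⟨l, (q : Q ⧸ K l)⟩ : Cosets K)) (map_one f)

theorem relToCoset_comp_relHomologyMap (n : ℕ) :
    relToCoset K A n ∘ₗ relHomologyMap f hf A (n + 1) =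
      (groupHomology.map f (tensorMap f A (cosetRepMap k f hf)) n).hom ∘ₗ
        relToCoset H (Rep.res f A) n := by
  have h := groupHomology.map_comp_map f (homologySeqMap f hf A).comm₁₂.symm n
  exact congrArg ModuleCat.Hom.hom (Iso.conj_comp_hom_comp
    (relHomologyIso H (Rep.res f A) n) (relHomologyIso K A n) h)

/-- The boundary is defined through the inverse of Shapiro's map for `K`, so the square is checked
after applying that injective map. -/
theorem subHomologyMap_comp_homologyBoundary (n : ℕ) :
    subHomologyMap f hf A n ∘ₗ homologyBoundary H (Rep.res f A) n =
      homologyBoundary K A n ∘ₗ relHomologyMap f hf A (n + 1) := by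
  rw [← LinearMap.cancel_left (bijective_homologyShapiro K n A).1, ← LinearMap.comp_assoc,
    ← map_comp_homologyShapiro, LinearMap.comp_assoc, isHomologyBoundary_homologyBoundary,
    ← LinearMap.comp_assoc, isHomologyBoundary_homologyBoundary, relToCoset_comp_relHomologyMap]

/-- Up to the Tor isomorphisms this is `bijective_map_tensorMap` for Δ_G → Δ_Q, with relative degree
n + 1 corresponding to degree n of group homology. -/
theorem bijective_relHomologyMap
    [Projective (Rep.res f (regularRep k Q) ⊗ relModule k H)]
    (h₀ : ∀ A : Rep.{u} k Q, Function.Bijective (groupHomology.map f (relTensorMap f hf A) 0).hom) :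
    ∀ n, Function.Bijective (relHomologyMap f hf A n)
  | 0 => ⟨fun _ _ _ => Subsingleton.elim (α := PUnit) _ _,
      fun _ => ⟨0, Subsingleton.elim (α := PUnit) _ _⟩⟩
  | n + 1 => by
    have h : Function.Bijective (groupHomology.map f (relTensorMap f hf A) n).hom :=
      bijective_map_tensorMap f (relModuleMap k f hf) h₀ n A
    exact (relHomologyIso K A n).symm.toLinearEquiv.bijective.comp
      (h.comp (relHomologyIso H (Rep.res f A) n).toLinearEquiv.bijective)

end Homology

section Cohomology

/-- The map from the sequence `A → Hom(⊕_λ k[Q/K_λ], A) → Hom(Δ_Q, A)` to its analogue for `G`. -/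
def cohomologySeqMap :
    (cohomologySeq K A).map (Rep.resFunctor f) ⟶ cohomologySeq H (Rep.res f A) where
  τ₁ := 𝟙 _
  τ₂ := ihomMap f A (cosetRepMap k f hf)
  τ₃ := relHomMap f hf A
  comm₁₂ := Rep.hom_ext (Representation.IntertwiningMap.ext (LinearMap.ext fun a =>
    LinearMap.ext fun v => congrArg (fun c : k => c • (show A.V from a))
      (augLin_cosetLin f hf v).symm))
  comm₂₃ := rfl

theorem cohomologyRestr_comp_cohomologyMap (n : ℕ) :
    cohomologyRestr H (Rep.res f A) n ∘ₗ cohomologyMap f A n =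
      subCohomologyMap f hf A n ∘ₗ cohomologyRestr K A n := by
  refine LinearMap.ext fun x => funext fun l => ?_
  exact LinearMap.congr_fun (congrArg ModuleCat.Hom.hom
    ((groupCohomology.map_comp f (H l).subtype (𝟙 (Rep.res f A))
      (𝟙 (Rep.res (H l).subtype (Rep.res f A))) n).symm.trans
        ((groupCohomology.map_congr rfl rfl n).trans
          (groupCohomology.map_comp (B := Rep.res (K l).subtype A)
            (C := Rep.res (H l).subtype (Rep.res f A))
              (K l).subtype (subMap f hf l) (𝟙 _) (𝟙 _) n)))) x

theorem cohomologyMap_comp_relToCohomology [Nonempty Λ] (n : ℕ) :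
    cohomologyMap f A n ∘ₗ relToCohomology K A n =
      relToCohomology H (Rep.res f A) n ∘ₗ relCohomologyMap f hf A n := by
  cases n with
  | zero => exact LinearMap.ext fun x => map_zero (cohomologyMap f A 0)
  | succ n =>
    have h := groupCohomology.δ_comp_map (cohomologySeq_shortExact H (Rep.res f A))
      (cohomologySeq_shortExact K A) f (cohomologySeqMap f hf A) n
    exact (congrArg ModuleCat.Hom.hom (Iso.conj_comp_hom_comp
      (relCohomologyIso K A n) (relCohomologyIso H (Rep.res f A) n) h)).symm

theorem subCohomologyMap_comp_cohomologyShapiro (n : ℕ) :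
    subCohomologyMap f hf A n ∘ₗ cohomologyShapiro K A n =
      cohomologyShapiro H (Rep.res f A) n ∘ₗ
        (groupCohomology.map f (ihomMap f A (cosetRepMap k f hf)) n).hom := by
  refine LinearMap.ext fun x => funext fun l => ?_
  refine LinearMap.congr_fun (congrArg ModuleCat.Hom.hom
    ((groupCohomology.map_comp (B := Rep.res (K l).subtype A)
      (C := Rep.res (H l).subtype (Rep.res f A)) (K l).subtype (subMap f hf l)
        (evalSummand K A l) (𝟙 _) n).symm.trans ((groupCohomology.map_congr rfl ?_ n).trans
          (groupCohomology.map_comp f (H l).subtype (ihomMap f A (cosetRepMap k f hf))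
            (evalSummand H (Rep.res f A) l) n)))) x
  refine LinearMap.ext fun (φ : MonoidAlgebra k (Cosets K) →ₗ[k] A.V) => ?_
  change φ (MonoidAlgebra.single _ 1) = φ (cosetLin k f hf (MonoidAlgebra.single _ 1))
  rw [cosetLin_single]
  congr 2
  exact congrArg (fun q : Q => (⟨l, (q : Q ⧸ K l)⟩ : Cosets K)) (map_one f).symm

theorem relCohomologyMap_comp_cosetToRel (n : ℕ) :
    relCohomologyMap f hf A (n + 1) ∘ₗ cosetToRel K A n =
      cosetToRel H (Rep.res f A) n ∘ₗ
        (groupCohomology.map f (ihomMap f A (cosetRepMap k f hf)) n).hom := by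
  have h := groupCohomology.map_comp_map f (cohomologySeqMap f hf A).comm₂₃.symm n
  exact congrArg ModuleCat.Hom.hom (Iso.comp_inv_comp_conj
    (relCohomologyIso K A n) (relCohomologyIso H (Rep.res f A) n) h)

/-- Checked after precomposing with the surjective Shapiro map for `K`. -/
theorem relCohomologyMap_comp_cohomologyCoboundary (n : ℕ) :
    relCohomologyMap f hf A (n + 1) ∘ₗ cohomologyCoboundary K A n =
      cohomologyCoboundary H (Rep.res f A) n ∘ₗ subCohomologyMap f hf A n := by
  rw [← LinearMap.cancel_right (bijective_cohomologyShapiro K n A).2, LinearMap.comp_assoc,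
    LinearMap.comp_assoc, isCohomologyCoboundary_cohomologyCoboundary,
    subCohomologyMap_comp_cohomologyShapiro, ← LinearMap.comp_assoc,
    isCohomologyCoboundary_cohomologyCoboundary, relCohomologyMap_comp_cosetToRel]

theorem bijective_relCohomologyMap
    [Projective (Rep.res f (regularRep k Q) ⊗ relModule k H)]
    (h₀ : ∀ A : Rep.{u} k Q, Function.Bijective (groupCohomology.map f (relHomMap f hf A) 0).hom) :
    ∀ n, Function.Bijective (relCohomologyMap f hf A n)
  | 0 => ⟨fun _ _ _ => Subsingleton.elim (α := PUnit) _ _,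
      fun _ => ⟨0, Subsingleton.elim (α := PUnit) _ _⟩⟩
  | n + 1 => by
    have h : Function.Bijective (groupCohomology.map f (relHomMap f hf A) n).hom :=
      bijective_map_ihomMap f (relModuleMap k f hf) h₀ n A
    exact (relCohomologyIso H (Rep.res f A) n).symm.toLinearEquiv.bijective.comp
      (h.comp (relCohomologyIso K A n).toLinearEquiv.bijective)

end Cohomology

end
end GroupPair

/-! ### Comparison in degree zero, and projectivity of induced modules. -/

namespace GroupPair

noncomputable section

variable {k G Q : Type u} [CommRing k] [Group G] [Group Q] (f : G →* Q)

section DegreeZero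

variable {M : Rep.{u} k G} {M' : Rep.{u} k Q} (m : M ⟶ Rep.res f M') (A : Rep.{u} k Q)

/-- The kernel of `f` acts trivially on the restriction of `A`, so a ⊗ (nw − w) = n(a ⊗ w) − a ⊗ w.
-/
theorem tmul_mem_coinvariantsKer {v : M.V}
    (hv : v ∈ Representation.Coinvariants.ker (M.ρ.comp f.ker.subtype)) (a : A.V) :
    a ⊗ₜ[k] v ∈ Representation.Coinvariants.ker (Rep.res f A ⊗ M).ρ := by
  let μ : M.V →ₗ[k] TensorProduct k A.V M.V := TensorProduct.mk k A.V M.V a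
  refine (Submodule.span_le.2 ?_ : Representation.Coinvariants.ker (M.ρ.comp f.ker.subtype) ≤
    (Representation.Coinvariants.ker (Rep.res f A ⊗ M).ρ).comap μ) hv
  rintro _ ⟨⟨n, w⟩, rfl⟩
  refine Representation.Coinvariants.mem_ker_of_eq (n : G) (a ⊗ₜ[k] w) _ ?_
  change A.ρ (f n) a ⊗ₜ[k] M.ρ n w - _ = a ⊗ₜ[k] (M.ρ n w - w)
  rw [n.2, map_one, Module.End.one_apply, TensorProduct.tmul_sub]

/-- The hypotheses say that `M'` is the module of coinvariants of `M` under ker f; taking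
G-coinvariants of A ⊗ M amounts to taking ker f-coinvariants first and then Q-coinvariants. -/
theorem bijective_map_tensorMap_zero (hf : Function.Surjective f) (hm : Function.Surjective m.hom)
    (hker : ∀ v, m.hom v = 0 → v ∈ Representation.Coinvariants.ker (M.ρ.comp f.ker.subtype)) :
    Function.Bijective (groupHomology.map f (tensorMap f A m) 0).hom := by
  let μ : TensorProduct k A.V M.V →ₗ[k] TensorProduct k A.V M'.V :=
    m.hom.toLinearMap.lTensor A.V
  have hμ : Function.Surjective μ := LinearMap.lTensor_surjective A.V hm
  have hmap (t : TensorProduct k A.V M.V) :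
      (groupHomology.map f (tensorMap f A m) 0).hom (groupHomology.H0π (Rep.res f A ⊗ M) t) =
        groupHomology.H0π (A ⊗ M') (μ t) := groupHomology.map_H0π f (tensorMap f A m) t
  constructor
  · rw [injective_iff_map_eq_zero]
    intro x hx
    obtain ⟨t, rfl⟩ := groupHomology.surjective_H0π _ x
    change TensorProduct k A.V M.V at t
    rw [groupHomology.H0π_eq_zero_iff]
    have ht : μ t ∈ Representation.Coinvariants.ker (A ⊗ M').ρ :=
      (groupHomology.H0π_eq_zero_iff _ _).1 ((hmap t).symm.trans hx)
    -- Each relation q s − s over `Q` lifts to one over `G`, because `f` and `μ` are surjective.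
    have hle : Representation.Coinvariants.ker (A ⊗ M').ρ ≤
        (Representation.Coinvariants.ker (Rep.res f A ⊗ M).ρ).map μ := by
      refine Submodule.span_le.2 ?_
      rintro _ ⟨⟨q, s⟩, rfl⟩
      obtain ⟨g, rfl⟩ := hf q
      obtain ⟨s, rfl⟩ := hμ s
      refine ⟨_, Representation.Coinvariants.sub_mem_ker g s, ?_⟩
      refine (map_sub μ _ _).trans (congrArg (· - μ s) ?_)
      exact Rep.hom_comm_apply (tensorMap f A m) g s
    obtain ⟨s, hs, hst⟩ := hle ht
    -- The remaining difference t − s lies in ker μ, which right exactness of the tensor product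
    -- describes as the image of A ⊗ ker m.
    have hex : Function.Exact ((LinearMap.ker m.hom.toLinearMap).subtype.lTensor A.V) μ :=
      lTensor_exact A.V (LinearMap.exact_subtype_ker_map _) hm
    obtain ⟨w, hw⟩ := (hex (t - s)).1 (by rw [map_sub, hst, sub_self])
    have hw' : t - s ∈ Representation.Coinvariants.ker (Rep.res f A ⊗ M).ρ := by
      rw [← hw]
      clear hw
      induction w using TensorProduct.induction_on with
      | zero => rw [map_zero]; exact zero_mem _
      | tmul a v => exact tmul_mem_coinvariantsKer f A (hker v.1 v.2) a
      | add x y hx hy => rw [map_add]; exact add_mem hx hy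
    have := add_mem hw' hs
    rwa [sub_add_cancel] at this
  · intro y
    obtain ⟨t, rfl⟩ := groupHomology.surjective_H0π _ y
    obtain ⟨t, rfl⟩ := hμ t
    exact ⟨_, hmap t⟩

/-- A G-equivariant map from `M` to the restriction of `A` kills every nw − w with n ∈ ker f, hence
factors through `m`; the factorisation is Q-equivariant because `f` and `m` are surjective. -/
theorem bijective_map_ihomMap_zero (hf : Function.Surjective f) (hm : Function.Surjective m.hom)
    (hker : ∀ v, m.hom v = 0 → v ∈ Representation.Coinvariants.ker (M.ρ.comp f.ker.subtype)) :
    Function.Bijective (groupCohomology.map f (ihomMap f A m) 0).hom := by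
  have hmap (x) : groupCohomology.H0ι _ ((groupCohomology.map f (ihomMap f A m) 0).hom x) =
      (show M'.V →ₗ[k] A.V from groupCohomology.H0ι _ x) ∘ₗ m.hom.toLinearMap :=
    groupCohomology.H0ι_map f (ihomMap f A m) x
  constructor
  · intro x y hxy
    refine groupCohomology.injective_H0ι _ ?_
    have h := (hmap x).symm.trans ((congrArg (groupCohomology.H0ι _) hxy).trans (hmap y))
    exact (LinearMap.cancel_right (g := m.hom.toLinearMap) hm).1 h
  · intro y
    have hinv := groupCohomology.H0ι_mem _ y
    obtain ⟨ψ, hψ⟩ : ∃ ψ : M.V →ₗ[k] A.V, ψ = groupCohomology.H0ι _ y := ⟨_, rfl⟩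
    have hψG (g : G) (v : M.V) : ψ (M.ρ g v) = A.ρ (f g) (ψ v) := by
      have h : A.ρ (f g) (ψ (M.ρ g⁻¹ (M.ρ g v))) = ψ (M.ρ g v) := by
        rw [hψ]
        exact LinearMap.congr_fun (hinv g) (M.ρ g v)
      rw [← h, ← Module.End.mul_apply (M.ρ g⁻¹), ← map_mul, inv_mul_cancel, map_one,
        Module.End.one_apply]
    have hle : LinearMap.ker m.hom.toLinearMap ≤ LinearMap.ker ψ := by
      intro v hv
      refine (Submodule.span_le.2 ?_ : Representation.Coinvariants.ker
        (M.ρ.comp f.ker.subtype) ≤ LinearMap.ker ψ) (hker v hv)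
      rintro _ ⟨⟨n, w⟩, rfl⟩
      change ψ (M.ρ n w - w) = 0
      rw [map_sub, hψG, n.2, map_one, Module.End.one_apply, sub_self]
    let φ : M'.V →ₗ[k] A.V := (LinearMap.ker m.hom.toLinearMap).liftQ ψ hle ∘ₗ
      (m.hom.toLinearMap.quotKerEquivOfSurjective hm).symm.toLinearMap
    have hφ (v : M.V) : φ (m.hom v) = ψ v := by
      have h : (m.hom.toLinearMap.quotKerEquivOfSurjective hm).symm (m.hom v) =
          Submodule.Quotient.mk v := by
        rw [LinearEquiv.symm_apply_eq]
        rfl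
      exact (congrArg ((LinearMap.ker m.hom.toLinearMap).liftQ ψ hle) h).trans
        (Submodule.liftQ_apply _ _ _)
    obtain ⟨x, hx⟩ := groupCohomology.exists_H0ι_eq ((Rep.ihom M').obj A) φ (by
      intro q
      obtain ⟨g, rfl⟩ := hf q
      refine (LinearMap.cancel_right (g := m.hom.toLinearMap) hm).1 (LinearMap.ext fun v => ?_)
      change A.ρ (f g) (φ (M'.ρ (f g)⁻¹ (m.hom v))) = φ (m.hom v)
      have h : M'.ρ (f g)⁻¹ (m.hom v) = m.hom (M.ρ g⁻¹ v) := by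
        rw [← map_inv]
        exact (Rep.hom_comm_apply m g⁻¹ v).symm
      rw [h, hφ, hφ, ← hψG, ← Module.End.mul_apply, ← map_mul, mul_inv_cancel, map_one,
        Module.End.one_apply])
    refine ⟨x, groupCohomology.injective_H0ι _ ?_⟩
    refine (hmap x).trans ?_
    rw [hx, ← hψ]
    exact LinearMap.ext hφ

end DegreeZero

/-- The module k[Q] ⊗ M is induced from the restriction of `M` to ker f, with slice 1 ⊗ M, and
induction preserves projectives. The lifting property is checked directly. -/
theorem projective_regularRep_tensor (hf : Function.Surjective f) (M : Rep.{u} k G)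
    [Projective (Rep.res f.ker.subtype M)] : Projective (Rep.res f (regularRep k Q) ⊗ M) := by
  refine ⟨fun {E Y} φ e he => ?_⟩
  let b (q : Q) : MonoidAlgebra k (Cosets (botFamily Q)) :=
    MonoidAlgebra.single (toBotCosets q) 1
  let φ' : TensorProduct k (MonoidAlgebra k (Cosets (botFamily Q))) M.V →ₗ[k] Y.V :=
    φ.hom.toLinearMap
  have hφ (g : G) (q : Q) (v : M.V) : φ' (b (f g * q) ⊗ₜ M.ρ g v) = Y.ρ g (φ' (b q ⊗ₜ v)) := by
    refine Eq.trans (congrArg φ' ?_) (Rep.hom_comm_apply φ g (b q ⊗ₜ v))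
    change _ = Representation.ofMulAction k Q _ (f g) (b q) ⊗ₜ M.ρ g v
    rw [Representation.ofMulAction_single]
    rfl
  -- Restriction of `φ` to the slice 1 ⊗ M, which ker f preserves; it lifts by projectivity over ker
  -- f.
  let φ₁ : Rep.res f.ker.subtype M ⟶ Rep.res f.ker.subtype Y :=
    Rep.ofHom ⟨φ' ∘ₗ TensorProduct.mk k _ M.V (b 1), fun n => LinearMap.ext fun v => by
      have h := hφ n 1 v
      rw [n.2, one_mul] at h
      exact h⟩
  have he' : Epi ((Rep.resFunctor f.ker.subtype).map e) := by
    rw [Rep.epi_iff_surjective] at he ⊢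
    exact he
  obtain ⟨ψ, hψ⟩ := Projective.factors φ₁ ((Rep.resFunctor f.ker.subtype).map e)
  let ψ' : M.V →ₗ[k] E.V := ψ.hom.toLinearMap
  have hψe (v : M.V) : e.hom (ψ' v) = φ' (b 1 ⊗ₜ v) :=
    LinearMap.congr_fun (congrArg (fun t => t.hom.toLinearMap) hψ) v
  have hψn (n : G) (hn : f n = 1) (v : M.V) : ψ' (M.ρ n v) = E.ρ n (ψ' v) :=
    Rep.hom_comm_apply ψ (⟨n, hn⟩ : f.ker) v
  -- The translate of the lift to the slice over f g; ker f-equivariance of `ψ'` makes it depend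
  -- only on f g.
  let L (g : G) : M.V →ₗ[k] E.V := E.ρ g ∘ₗ ψ' ∘ₗ M.ρ g⁻¹
  have hL (g g' : G) (h : f g = f g') : L g = L g' := by
    refine LinearMap.ext fun v => ?_
    change E.ρ g (ψ' (M.ρ g⁻¹ v)) = E.ρ g' (ψ' (M.ρ g'⁻¹ v))
    have h1 : M.ρ g'⁻¹ v = M.ρ (g'⁻¹ * g) (M.ρ g⁻¹ v) := by
      rw [← Module.End.mul_apply, ← map_mul, mul_inv_cancel_right]
    rw [h1, hψn (g'⁻¹ * g) (by rw [map_mul, map_inv, h, inv_mul_cancel]), ← Module.End.mul_apply (E.ρ g'),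
      ← map_mul, mul_inv_cancel_left]
  let s : Cosets (botFamily Q) → G := fun x => Function.surjInv hf (toBotCosets.symm x)
  have hs (x) : f (s x) = toBotCosets.symm x := Function.surjInv_eq hf _
  let Ψ : TensorProduct k (MonoidAlgebra k (Cosets (botFamily Q))) M.V →ₗ[k] E.V :=
    TensorProduct.lift ((Finsupp.linearCombination k fun x => L (s x)) ∘ₗ
      (MonoidAlgebra.coeffLinearEquiv k).toLinearMap)
  have hΨ (x) (v : M.V) : Ψ (MonoidAlgebra.single x 1 ⊗ₜ v) = L (s x) v := by
    simp [Ψ]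
  refine ⟨Rep.ofHom ⟨Ψ, fun g => ?_⟩, ?_⟩
  · refine TensorProduct.ext (MonoidAlgebra.lhom_ext' fun x => LinearMap.ext_ring
      (LinearMap.ext fun v => ?_))
    change Ψ (Representation.ofMulAction k Q _ (f g) (MonoidAlgebra.single x 1) ⊗ₜ M.ρ g v) =
      E.ρ g (Ψ (MonoidAlgebra.single x 1 ⊗ₜ v))
    rw [Representation.ofMulAction_single, hΨ, hΨ, hL (s (f g • x)) (g * s x)]
    · change E.ρ (g * s x) (ψ' (M.ρ (g * s x)⁻¹ (M.ρ g v))) = E.ρ g (E.ρ (s x) (ψ' (M.ρ _ v)))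
      rw [map_mul, Module.End.mul_apply, mul_inv_rev, ← Module.End.mul_apply (M.ρ _), ← map_mul,
        inv_mul_cancel_right]
    · rw [hs, map_mul, hs, Equiv.symm_apply_eq, toBotCosets_smul, Equiv.apply_symm_apply]
  · refine Rep.hom_ext (Representation.IntertwiningMap.ext (TensorProduct.ext
      (MonoidAlgebra.lhom_ext' fun x => LinearMap.ext_ring (LinearMap.ext fun v => ?_))))
    change e.hom (Ψ (MonoidAlgebra.single x 1 ⊗ₜ v)) = φ' (MonoidAlgebra.single x 1 ⊗ₜ v)
    rw [hΨ]
    refine (Rep.hom_comm_apply e (s x) _).trans ((congrArg (Y.ρ (s x)) (hψe _)).trans ?_)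
    rw [← hφ, mul_one, hs, ← Module.End.mul_apply, ← map_mul, mul_inv_cancel, map_one,
      Module.End.one_apply]
    simp only [b, Equiv.apply_symm_apply]

end
end GroupPair

/-! ### Malnormality of free factors. -/

namespace Monoid.CoprodI

variable {ι : Type*} {M : ι → Type*} [∀ i, Group (M i)]

/-- Reduced words are unique, so a nonempty one representing an element of a single factor has
exactly one letter. -/
theorem NeWord.eq_of_prod_eq {i j : ι} (w : NeWord M i j) {l : ι} {m : M l}
    (h : w.prod = of m) : w.toList = [⟨l, m⟩] := by
  classical
  by_cases hm : m = 1
  · have h' : w.toWord = Word.empty := Word.equiv.symm.injective (by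
      change w.prod = Word.prod _
      rw [h, hm, map_one, Word.prod_empty])
    exact absurd (congrArg Word.toList h') w.toList_ne_nil
  · have h' : w.toWord = (NeWord.singleton m hm).toWord := Word.equiv.symm.injective (by
      change w.prod = (NeWord.singleton m hm).prod
      rw [h, NeWord.prod_singleton])
    exact congrArg Word.toList h'

/-- A nontrivial free factor is malnormal. -/
theorem mem_range_of_of_conj {i : ι} {m : M i} (hm : m ≠ 1) {x : CoprodI M}
    (h : x⁻¹ * of m * x ∈ (of : M i →* CoprodI M).range) :
    x ∈ (of : M i →* CoprodI M).range := by
  classical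
  obtain ⟨m', hm'⟩ := h
  -- Split x = h·t with h in the i-th factor and t a reduced word not starting in that factor; the
  -- claim is that t is empty.
  let p := Word.equivPair i (Word.equiv x)
  have hx : of p.head * p.tail.prod = x := by
    rw [← Word.prod_rcons, ← Word.equivPair_symm, Equiv.symm_apply_apply]
    exact Word.equiv.symm_apply_apply x
  by_cases hp : p.tail = Word.empty
  · exact ⟨p.head, by rw [← hx, hp, Word.prod_empty, mul_one]⟩
  obtain ⟨j, l, t, ht⟩ := NeWord.of_word p.tail hp
  have hij : i ≠ j := by
    intro hij
    apply p.fstIdx_ne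
    rw [← ht, Word.fstIdx]
    change t.toList.head?.map Sigma.fst = some i
    rw [NeWord.toList_head?, hij]
    rfl
  have hm1 : p.head⁻¹ * m * p.head ≠ 1 := fun h => hm (by
    have := congrArg (fun y => p.head * y * p.head⁻¹) h
    simpa [mul_assoc] using this)
  -- The word t⁻¹ · (h⁻¹mh) · t is reduced of length at least 3, yet represents an element of the
  -- i-th factor.
  let W := (t.inv.append hij.symm (NeWord.singleton _ hm1)).append hij t
  have htp : t.prod = p.tail.prod := congrArg Word.prod ht
  have hW : W.prod = of m' := by
    rw [hm', ← hx]
    simp only [W, NeWord.append_prod, NeWord.prod_singleton, NeWord.inv_prod, htp, map_mul,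
      map_inv, mul_inv_rev, mul_assoc]
  have h1 := congrArg List.length (W.eq_of_prod_eq hW)
  have h2 := List.length_pos_of_ne_nil t.toList_ne_nil
  have h3 := List.length_pos_of_ne_nil t.inv.toList_ne_nil
  simp only [W, NeWord.toList, List.length_append, List.length_singleton] at h1
  omega

end Monoid.CoprodI

/-! ### The relative module over a free product of stabilisers. -/

namespace GroupPair

noncomputable section

variable {k G Λ : Type u} [CommRing k] [Group G] (H : Λ → Subgroup G)

variable (k) in
/-- The element `[x] - [y]` of `Δ`. -/
def cosetSub (x y : Cosets H) : LinearMap.ker (augLin k H) :=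
  ⟨MonoidAlgebra.single x 1 - MonoidAlgebra.single y 1, by simp⟩

theorem relModule_ρ_cosetSub (g : G) (x y : Cosets H) :
    (relModule k H).ρ g (cosetSub k H x y) = cosetSub k H (g • x) (g • y) := by
  refine Subtype.ext ?_
  change Representation.ofMulAction k G (Cosets H) g (_ - _) = _
  rw [map_sub, Representation.ofMulAction_single, Representation.ofMulAction_single]
  rfl

section FreeProduct

theorem induction_on_freeProduct {I N : Type*} {M : I → Type*} [Group N] [∀ i, Group (M i)]
    {φ : ∀ i, M i →* N} (hφ : Function.Bijective (Monoid.CoprodI.lift φ)) {P : N → Prop} (n : N)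
    (h1 : P 1) (hof : ∀ i m, P (φ i m)) (hmul : ∀ a b, P a → P b → P (a * b)) : P n := by
  obtain ⟨c, rfl⟩ := hφ.2 n
  induction c using Monoid.CoprodI.induction_on with
  | one => rwa [map_one]
  | of i m => rw [Monoid.CoprodI.lift_of]; exact hof i m
  | mul x y hx hy => rw [map_mul]; exact hmul _ _ hx hy

/-- The affine action of a free product on a representation whose `i`-th factor fixes `e i`. -/
theorem exists_affineAction {k I N V : Type*} {M : I → Type*} [CommRing k] [Group N]
    [∀ i, Group (M i)] [AddCommGroup V] [Module k V] {φ : ∀ i, M i →* N}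
    (hφ : Function.Bijective (Monoid.CoprodI.lift φ)) (ρ : Representation k N V) (e : I → V) :
    ∃ θ : N →* Equiv.Perm V, (∀ n v w, θ n v - θ n w = ρ n (v - w)) ∧
      ∀ i m v, θ (φ i m) v = ρ (φ i m) (v - e i) + e i := by
  -- The linear action of the i-th factor conjugated by translation by e i; no relations link the
  -- factors, so these actions glue.
  let τ (i : I) : M i →* Equiv.Perm V := MonoidHom.toHomPerm
    { toFun := fun m v => ρ (φ i m) (v - e i) + e i
      map_one' := funext fun v => by simp [show (1 : Function.End V) v = v from rfl]
      map_mul' := fun a b => funext fun v => by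
        change _ = ρ (φ i a) (ρ (φ i b) (v - e i) + e i - e i) + e i
        rw [add_sub_cancel_right, map_mul, map_mul]
        rfl }
  let E := MulEquiv.ofBijective (Monoid.CoprodI.lift φ) hφ
  let θ : N →* Equiv.Perm V := (Monoid.CoprodI.lift τ).comp E.symm.toMonoidHom
  have hθ (i m v) : θ (φ i m) v = ρ (φ i m) (v - e i) + e i := by
    have h : E.symm (φ i m) = Monoid.CoprodI.of m :=
      E.symm_apply_eq.2 (Monoid.CoprodI.lift_of φ m).symm
    change Monoid.CoprodI.lift τ (E.symm (φ i m)) v = _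
    rw [h, Monoid.CoprodI.lift_of]
    rfl
  refine ⟨θ, fun n => ?_, hθ⟩
  refine induction_on_freeProduct hφ
    (P := fun n => ∀ v w, θ n v - θ n w = ρ n (v - w)) n (fun v w => by simp) (fun i m v w => ?_)
    fun a b ha hb v w => ?_
  · rw [hθ, hθ, add_sub_add_right_eq_sub, ← map_sub, sub_sub_sub_cancel_right]
  · rw [map_mul, map_mul, Equiv.Perm.mul_apply, Equiv.Perm.mul_apply, ha, hb]
    rfl

variable {I : Type u} {N : Subgroup G} {x : I → Cosets H} {M : I → Type u} [∀ i, Group (M i)]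
  {φ : ∀ i, M i →* N}

/-- Let V be the free kN-module on elements e_i, mapped to Δ by e_i ↦ [x_i] − [x_{i₀}]. Freeness of
the product gives an affine action of N on V in which the i-th factor fixes e_i. Since that factor
is the whole stabiliser of x_i and the x_i represent the orbits, n·x_i ↦ n·e_i is a well-defined map
from cosets to V. Its linear extension is affine-equivariant, hence kN-linear on augmentation 0,
where it splits V → Δ. -/
theorem projective_res_relModule [Nonempty I]
    (hφ : Function.Bijective (Monoid.CoprodI.lift φ))
    (hstab : ∀ i (n : N), (n : G) • x i = x i ↔ n ∈ (φ i).range)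
    (horb : ∀ y, ∃ i, ∃ n : N, (n : G) • x i = y)
    (huniq : ∀ i j (n : N), (n : G) • x i = x j → i = j) :
    Projective (Rep.res N.subtype (relModule k H)) := by
  classical
  obtain ⟨i₀⟩ := ‹Nonempty I›
  let V := Rep.free k N I
  let e (i : I) : V.V := Finsupp.single i (MonoidAlgebra.single 1 1)
  let Φ : V ⟶ Rep.res N.subtype (relModule k H) :=
    Rep.freeLift k N (Rep.res N.subtype (relModule k H)) fun i => cosetSub k H (x i) (x i₀)
  have hΦe (i) : Φ.hom (e i) = cosetSub k H (x i) (x i₀) :=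
    congrFun ((Rep.freeLiftLEquiv k N I (Rep.res N.subtype (relModule k H))).apply_symm_apply
      fun i => cosetSub k H (x i) (x i₀)) i
  obtain ⟨θ, hθ, hθφ⟩ := exists_affineAction hφ V.ρ e
  let b : MonoidAlgebra k (Cosets H) := MonoidAlgebra.single (x i₀) 1
  let F (v : V.V) : MonoidAlgebra k (Cosets H) := (show LinearMap.ker (augLin k H) from Φ.hom v).1
  have hFρ (n : N) (v) : F (V.ρ n v) = Representation.ofMulAction k G (Cosets H) n (F v) :=
    congrArg Subtype.val (Rep.hom_comm_apply Φ n v)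
  have hFadd (v w) : F (v + w) = F v + F w := congrArg Subtype.val (map_add Φ.hom v w)
  have hFsub (v w) : F (v - w) = F v - F w := congrArg Subtype.val (map_sub Φ.hom v w)
  have hFe (i) : F (e i) = MonoidAlgebra.single (x i) 1 - b := congrArg Subtype.val (hΦe i)
  -- Translating by b = [x_{i₀}] intertwines the affine action on `V` with the permutation action,
  -- because F(e_i) + b = [x_i] is fixed by the i-th factor.
  have hFθ (n : N) : ∀ v, F (θ n v) + b =
      Representation.ofMulAction k G (Cosets H) n (F v + b) := by
    refine induction_on_freeProduct hφ (P := fun n => ∀ v, F (θ n v) + b =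
      Representation.ofMulAction k G (Cosets H) n (F v + b)) n (fun v => by simp)
        (fun i m v => ?_) fun a c ha hc v => ?_
    · have h := (hstab i (φ i m)).2 ⟨m, rfl⟩
      rw [hθφ, hFadd, hFρ, hFsub, hFe, map_sub, map_sub, map_add, Representation.ofMulAction_single,
        h]
      abel
    · rw [map_mul, Equiv.Perm.mul_apply, ha, hc, Subgroup.coe_mul, map_mul]
      rfl
  choose i n hn using horb
  let Ψ (y : Cosets H) : V.V := θ (n y) (e (i y))
  -- The chosen representatives of m·y and of y have the same index, and the group elements differ
  -- by a stabiliser element, which fixes e_i under `θ`.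
  have hΨ (m : N) (y) : Ψ ((m : G) • y) = θ m (Ψ y) := by
    have h1 : (n ((m : G) • y) : G) • x (i ((m : G) • y)) = ((m * n y : N) : G) • x (i y) := by
      rw [hn, Subgroup.coe_mul, mul_smul, hn]
    have h2 : (((m * n y)⁻¹ * n ((m : G) • y) : N) : G) • x (i ((m : G) • y)) = x (i y) := by
      rw [Subgroup.coe_mul, mul_smul, h1, Subgroup.coe_inv, inv_smul_smul]
    have h3 := huniq _ _ _ h2
    rw [h3] at h2
    obtain ⟨c, hc⟩ := (hstab _ _).1 h2
    have h4 : n ((m : G) • y) = m * n y * φ (i y) c := by rw [hc]; group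
    change θ (n ((m : G) • y)) (e (i ((m : G) • y))) = θ m (θ (n y) (e (i y)))
    rw [h3, h4, map_mul, map_mul, Equiv.Perm.mul_apply, Equiv.Perm.mul_apply, hθφ, sub_self,
      map_zero, zero_add]
  have hFΨ (y) : F (Ψ y) = MonoidAlgebra.single y 1 - b := by
    refine eq_sub_of_add_eq ?_
    rw [hFθ, hFe, sub_add_cancel, Representation.ofMulAction_single, hn]
  let L : MonoidAlgebra k (Cosets H) →ₗ[k] V.V :=
    Finsupp.linearCombination k Ψ ∘ₗ (MonoidAlgebra.coeffLinearEquiv k).toLinearMap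
  have hL (y) : L (MonoidAlgebra.single y 1) = Ψ y := by simp [L]
  -- The failure of linear equivariance is the translation part θ_m(0) scaled by the augmentation;
  -- it disappears on Δ.
  have hLρ (m : N) (v) : L (Representation.ofMulAction k G (Cosets H) m v) =
      V.ρ m (L v) + augLin k H v • θ m 0 := by
    have : L ∘ₗ Representation.ofMulAction k G (Cosets H) m =
        V.ρ m ∘ₗ L + (augLin k H).smulRight (θ m 0) :=
      MonoidAlgebra.lhom_ext' fun y => LinearMap.ext_ring <| by
        have := hθ m (Ψ y) 0
        rw [sub_zero, ← hΨ] at this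
        simp only [LinearMap.coe_comp, Function.comp_apply, MonoidAlgebra.lsingle_apply,
          Representation.ofMulAction_single, LinearMap.add_apply, LinearMap.smulRight_apply,
          augLin_single, one_smul, hL]
        exact eq_add_of_sub_eq this
    exact LinearMap.congr_fun this v
  have hFL (v) : F (L v) = v - augLin k H v • b := by
    have : (LinearMap.ker (augLin k H)).subtype ∘ₗ Φ.hom.toLinearMap ∘ₗ L =
        LinearMap.id - (augLin k H).smulRight b :=
      MonoidAlgebra.lhom_ext' fun y => LinearMap.ext_ring <| by
        simp only [LinearMap.coe_comp, Function.comp_apply, MonoidAlgebra.lsingle_apply,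
          LinearMap.sub_apply, LinearMap.smulRight_apply, augLin_single, one_smul, hL,
          LinearMap.id_apply]
        exact hFΨ y
    exact LinearMap.congr_fun this v
  let s : Rep.res N.subtype (relModule k H) ⟶ V :=
    Rep.ofHom ⟨L ∘ₗ (LinearMap.ker (augLin k H)).subtype, fun m =>
      LinearMap.ext fun (v : LinearMap.ker (augLin k H)) => by
        have := hLρ m v.1
        rw [LinearMap.mem_ker.1 v.2, zero_smul, add_zero] at this
        exact this⟩
  have hs : s ≫ Φ = 𝟙 _ := Rep.hom_ext (Representation.IntertwiningMap.ext
    (LinearMap.ext fun (v : LinearMap.ker (augLin k H)) => Subtype.ext (by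
      have := hFL v.1
      rw [LinearMap.mem_ker.1 v.2, zero_smul, sub_zero] at this
      exact this)))
  have : Projective V := Rep.free_projective
  exact (Retract.mk s Φ hs).projective

theorem cosetSub_add_cosetSub (x y z : Cosets H) :
    cosetSub k H x y + cosetSub k H y z = cosetSub k H x z :=
  Subtype.ext (sub_add_sub_cancel _ _ _)

/-- If m fixes x_i, then [my] − [y] = m([y] − [x_i]) − ([y] − [x_i]), a coinvariant relation inside
Δ. Products telescope, so generation by such elements suffices. -/
theorem cosetSub_smul_mem (hφ : Function.Bijective (Monoid.CoprodI.lift φ))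
    (hstab : ∀ i m, (φ i m : G) • x i = x i) (n : N) (y : Cosets H) :
    cosetSub k H ((n : G) • y) y ∈
      Representation.Coinvariants.ker ((relModule k H).ρ.comp N.subtype) := by
  refine induction_on_freeProduct hφ (P := fun n => ∀ y, cosetSub k H ((n : G) • y) y ∈
    Representation.Coinvariants.ker ((relModule k H).ρ.comp N.subtype)) n (fun y => ?_)
      (fun i m y => ?_) (fun a b ha hb y => ?_) y
  · rw [OneMemClass.coe_one, one_smul,
      show cosetSub k H y y = 0 from Subtype.ext (sub_self _)]
    exact zero_mem _
  · refine Representation.Coinvariants.mem_ker_of_eq (φ i m) (cosetSub k H y (x i)) _ ?_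
    change (relModule k H).ρ (φ i m : G) (cosetSub k H y (x i)) - cosetSub k H y (x i) = _
    rw [relModule_ρ_cosetSub, hstab, sub_eq_iff_eq_add]
    exact (cosetSub_add_cosetSub H _ _ _).symm
  · rw [Subgroup.coe_mul, mul_smul, ← cosetSub_add_cosetSub H _ ((b : G) • y)]
    exact add_mem (ha _) (hb _)

end FreeProduct

section Fibers

variable {H} {Q : Type u} [Group Q] {K : Λ → Subgroup Q} (f : G →* Q)
  (hf : ∀ l, H l ≤ (K l).comap f)

theorem surjective_cosetMap (hs : Function.Surjective f) :
    Function.Surjective (cosetMap f hf) := by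
  rintro ⟨l, y⟩
  obtain ⟨q, rfl⟩ := QuotientGroup.mk_surjective y
  obtain ⟨g, rfl⟩ := hs q
  exact ⟨⟨l, (g : G ⧸ H l)⟩, rfl⟩

/-- The linear section of `cosetLin` induced by a section of `cosetMap`. -/
theorem exists_section_cosetLin (hs : Function.Surjective f) :
    ∃ σ : MonoidAlgebra k (Cosets K) →ₗ[k] MonoidAlgebra k (Cosets H),
      cosetLin k f hf ∘ₗ σ = LinearMap.id ∧
      ∃ s : Cosets K → Cosets H, (∀ y, cosetMap f hf (s y) = y) ∧
        ∀ y, σ (MonoidAlgebra.single y 1) = MonoidAlgebra.single (s y) 1 := by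
  let s := Function.surjInv (surjective_cosetMap f hf hs)
  have hs' (y) : cosetMap f hf (s y) = y := Function.surjInv_eq _ y
  let σ : MonoidAlgebra k (Cosets K) →ₗ[k] MonoidAlgebra k (Cosets H) :=
    Finsupp.linearCombination k (fun y => MonoidAlgebra.single (s y) 1) ∘ₗ
      (MonoidAlgebra.coeffLinearEquiv k).toLinearMap
  have hσ (y) : σ (MonoidAlgebra.single y 1) = MonoidAlgebra.single (s y) 1 := by simp [σ]
  refine ⟨σ, MonoidAlgebra.lhom_ext' fun y => LinearMap.ext_ring ?_, s, hs', hσ⟩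
  simp only [LinearMap.coe_comp, Function.comp_apply, MonoidAlgebra.lsingle_apply, hσ,
    cosetLin_single, hs', LinearMap.id_apply]

theorem surjective_relModuleMap (hs : Function.Surjective f) :
    Function.Surjective (relModuleMap k f hf).hom := by
  obtain ⟨σ, hσ, -⟩ := exists_section_cosetLin (k := k) f hf hs
  intro (v : LinearMap.ker (augLin k K))
  have hv : cosetLin k f hf (σ v.1) = v.1 := LinearMap.congr_fun hσ v.1
  refine ⟨(⟨σ v.1, ?_⟩ : LinearMap.ker (augLin k H)), Subtype.ext hv⟩
  rw [LinearMap.mem_ker, ← augLin_cosetLin f hf, hv]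
  exact v.2

/-- The kernel of Δ_G → Δ_Q is spanned by differences of cosets in a common fibre; when fibres are
ker f-orbits these are the elements [ny] − [y]. -/
theorem mem_ker_of_relModuleMap_eq_zero (hs : Function.Surjective f)
    (hmem : ∀ (n : f.ker) (y : Cosets H), cosetSub k H ((n : G) • y) y ∈
      Representation.Coinvariants.ker ((relModule k H).ρ.comp f.ker.subtype))
    (hfib : ∀ y y', cosetMap f hf y = cosetMap f hf y' → ∃ n : f.ker, (n : G) • y = y')
    (v : relModule k H) (hv : (relModuleMap k f hf).hom v = 0) :
    v ∈ Representation.Coinvariants.ker ((relModule k H).ρ.comp f.ker.subtype) := by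
  obtain ⟨σ, -, s, hs', hσ⟩ := exists_section_cosetLin (k := k) f hf hs
  let W := Representation.Coinvariants.ker ((relModule k H).ρ.comp f.ker.subtype)
  -- The correction by the section `σ` is proved for all of k[⊔ G/H_λ], since linear induction on
  -- single cosets leaves Δ; for w in the kernel it vanishes.
  have key (w : MonoidAlgebra k (Cosets H)) :
      w - σ (cosetLin k f hf w) ∈ W.map (LinearMap.ker (augLin k H)).subtype := by
    induction w using MonoidAlgebra.induction_linear with
    | zero => simp
    | add a b ha hb => rw [map_add, map_add, add_sub_add_comm]; exact add_mem ha hb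
    | single y r =>
      obtain ⟨n, hn⟩ := hfib (s (cosetMap f hf y)) y (hs' _)
      have h : (MonoidAlgebra.single y r : MonoidAlgebra k (Cosets H)) =
        r • MonoidAlgebra.single y 1 := by simp
      rw [h, map_smul, map_smul, ← smul_sub, cosetLin_single, hσ]
      refine Submodule.smul_mem _ r ⟨_, hmem n (s (cosetMap f hf y)), ?_⟩
      rw [hn]
      rfl
  have hv' : cosetLin k f hf (show LinearMap.ker (augLin k H) from v).1 = 0 :=
    congrArg Subtype.val hv
  obtain ⟨w, hw, hwv⟩ := key (show LinearMap.ker (augLin k H) from v).1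
  rw [hv', map_zero, sub_zero] at hwv
  have : w = v := Subtype.ext hwv
  rwa [← this]

end Fibers
end
end GroupPair

/-! ### Cohen–Lyndon triples: stabilisers, orbits and excision. -/

namespace DehnFilling

open GroupPair

noncomputable section

variable {G Λ : Type u} [Group G] (H : Λ → Subgroup G) (N : ∀ l, Subgroup (H l))

theorem kernelIn_le_normalHull (l : Λ) : kernelIn H N l ≤ normalHull H N := fun _ hn =>
  Subgroup.subset_normalClosure (Set.mem_iUnion.2 ⟨l, hn⟩)

theorem conjKernel_le_normalHull (l : Λ) (t : G) : conjKernel H N l t ≤ normalHull H N := by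
  rintro _ ⟨n, hn, rfl⟩
  exact (normalHull_normal H N).conj_mem n (kernelIn_le_normalHull H N l hn) t

theorem ker_proj : (proj H N).ker = normalHull H N := QuotientGroup.ker_mk' _

/-- The inclusion of a conjugate `t N_λ t⁻¹` into the kernel of `G → Ḡ`. -/
def conjKernelIncl (l : Λ) (t : G) : conjKernel H N l t →* (proj H N).ker :=
  (conjKernel H N l t).subtype.codRestrict _ fun n => by
    rw [ker_proj]
    exact conjKernel_le_normalHull H N l t n.2

variable {H N} {T : Λ → Set G}

theorem bijective_lift_conjKernelIncl
    (hinj : Function.Injective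
      (Monoid.CoprodI.lift fun p : Σ l, T l => (conjKernel H N p.1 p.2).subtype))
    (hrange : (Monoid.CoprodI.lift fun p : Σ l, T l => (conjKernel H N p.1 p.2).subtype).range =
      normalHull H N) :
    Function.Bijective
      (Monoid.CoprodI.lift fun p : Σ l, T l => conjKernelIncl H N p.1 (p.2 : G)) := by
  have h : (proj H N).ker.subtype.comp
      (Monoid.CoprodI.lift fun p : Σ l, T l => conjKernelIncl H N p.1 (p.2 : G)) =
      Monoid.CoprodI.lift fun p : Σ l, T l => (conjKernel H N p.1 p.2).subtype :=
    Monoid.CoprodI.ext_hom _ _ fun p => MonoidHom.ext fun n => by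
      simp only [MonoidHom.comp_apply, Monoid.CoprodI.lift_of]
      rfl
  rw [← h] at hinj hrange
  refine ⟨fun a b hab => hinj (congrArg Subtype.val hab), fun n => ?_⟩
  obtain ⟨c, hc⟩ := hrange.ge ((ker_proj H N).le n.2)
  exact ⟨c, Subtype.ext hc⟩

/-- In a Cohen–Lyndon triple, `H_λ` meets the normal hull in `N_λ`. -/
theorem inf_normalHull_le (l : Λ)
    (hT : (T l).Nonempty)
    (hinj : Function.Injective
      (Monoid.CoprodI.lift fun p : Σ l, T l => (conjKernel H N p.1 p.2).subtype))
    (hrange : (Monoid.CoprodI.lift fun p : Σ l, T l => (conjKernel H N p.1 p.2).subtype).range =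
      normalHull H N) [(N l).Normal] (htriv : N l = ⊥ → H l ⊓ normalHull H N = ⊥) :
    H l ⊓ normalHull H N ≤ kernelIn H N l := by
  -- Malnormality says nothing about a trivial factor, so this case is supplied by the hypothesis.
  by_cases hN : N l = ⊥
  · rw [htriv hN]
    exact bot_le
  obtain ⟨m, hm, hm1⟩ := (Subgroup.ne_bot_iff_exists_ne_one (H := N l)).1 hN |>.elim
    fun a ha => (⟨a.1, a.2, fun h => ha (Subtype.ext h)⟩ : ∃ m : H l, m ∈ N l ∧ m ≠ 1)
  obtain ⟨t, ht⟩ := hT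
  rintro h ⟨hh, hh'⟩
  let p : Σ l, T l := ⟨l, t, ht⟩
  have hz : t * h * t⁻¹ ∈ normalHull H N := (normalHull_normal H N).conj_mem h hh' t
  rw [← hrange] at hz
  obtain ⟨ζ, hζ⟩ := hz
  let c (y : H l) (hy : y ∈ N l) : conjKernel H N p.1 p.2 := ⟨t * y * t⁻¹, y, ⟨y, hy, rfl⟩, rfl⟩
  have hc : c m hm ≠ 1 := fun h => hm1 (Subtype.ext (conj_eq_one_iff.1 (congrArg Subtype.val h)))
  have hmem : (⟨h, hh⟩ : H l)⁻¹ * m * ⟨h, hh⟩ ∈ N l := by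
    simpa using Subgroup.Normal.conj_mem ‹(N l).Normal› m hm (⟨h, hh⟩ : H l)⁻¹
  -- An element h ∈ H_l normalises N_l, so tht⁻¹, here `ζ`, conjugates a nontrivial element of the
  -- factor tN_lt⁻¹ into that factor; by malnormality it lies in the factor.
  have hconj : ζ⁻¹ * Monoid.CoprodI.of (i := p) (c m hm) * ζ =
      Monoid.CoprodI.of (i := p) (c _ hmem) := hinj (by
    rw [map_mul, map_mul, map_inv, hζ, Monoid.CoprodI.lift_of, Monoid.CoprodI.lift_of]
    change (t * h * t⁻¹)⁻¹ * (t * m * t⁻¹) * (t * h * t⁻¹) = t * (h⁻¹ * m * h) * t⁻¹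
    group)
  obtain ⟨⟨_, y, hy, rfl⟩, hyζ⟩ := Monoid.CoprodI.mem_range_of_of_conj hc ⟨_, hconj.symm⟩
  rw [← hyζ, Monoid.CoprodI.lift_of] at hζ
  have : y = h := by
    have h1 : t * y * t⁻¹ = t * h * t⁻¹ := hζ
    simpa using h1
  rwa [← this]

theorem injective_barHom [∀ l, (N l).Normal] (l : Λ)
    (h : H l ⊓ normalHull H N ≤ kernelIn H N l) : Function.Injective (barHom H N l) := by
  rw [injective_iff_map_eq_one]
  intro a ha
  obtain ⟨a, rfl⟩ := QuotientGroup.mk_surjective a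
  have ha' : (a : G) ∈ normalHull H N := (QuotientGroup.eq_one_iff (a : G)).1 ha
  obtain ⟨n, hn, hna⟩ := h ⟨a.2, ha'⟩
  have : n = a := Subtype.ext hna
  rw [QuotientGroup.eq_one_iff, ← this]
  exact hn

theorem exists_smul_mk_eq (l : Λ) {g g' a : G} (ha : a ∈ H l)
    (h : a⁻¹ * (g⁻¹ * g') ∈ normalHull H N) :
    ∃ n : (proj H N).ker, (n : G) • (⟨l, (g : G ⧸ H l)⟩ : Cosets H) = ⟨l, (g' : G ⧸ H l)⟩ := by
  -- This element equals g'a⁻¹g⁻¹ and carries g to g'a⁻¹, in the coset g'H_l.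
  have hn : g * a * (a⁻¹ * (g⁻¹ * g')) * (g * a)⁻¹ ∈ (proj H N).ker :=
    (ker_proj H N).ge ((normalHull_normal H N).conj_mem _ h (g * a))
  refine ⟨⟨_, hn⟩, ?_⟩
  change (⟨l, ((g * a * (a⁻¹ * (g⁻¹ * g')) * (g * a)⁻¹ * g : G) : G ⧸ H l)⟩ : Cosets H) = _
  rw [QuotientGroup.eq.2 (?_ : _ ∈ H l)]
  convert ha using 1
  group

theorem smul_mk_eq_iff (l : Λ) (n g g' : G) :
    n • (⟨l, (g : G ⧸ H l)⟩ : Cosets H) = ⟨l, (g' : G ⧸ H l)⟩ ↔ (n * g)⁻¹ * g' ∈ H l := by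
  rw [← QuotientGroup.eq]
  change (⟨l, ((n * g : G) : G ⧸ H l)⟩ : Cosets H) = _ ↔ _
  simp

/-- Equal images mean g' ∈ gH_l𝒩, and normality moves the element of 𝒩 to the left: fibres are
𝒩-orbits. -/
theorem exists_smul_eq_of_cosetMap_eq [∀ l, (N l).Normal] (y y' : Cosets H)
    (h : cosetMap (proj H N) (le_comap_barSubgroup H N) y =
      cosetMap (proj H N) (le_comap_barSubgroup H N) y') :
    ∃ n : (proj H N).ker, (n : G) • y = y' := by
  obtain ⟨l, y⟩ := y
  obtain ⟨l', y'⟩ := y'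
  obtain rfl : l = l' := congrArg Sigma.fst h
  obtain ⟨g, rfl⟩ := QuotientGroup.mk_surjective y
  obtain ⟨g', rfl⟩ := QuotientGroup.mk_surjective y'
  have h' : ((proj H N g : Filling H N) : Filling H N ⧸ barSubgroup H N l) = proj H N g' :=
    eq_of_heq (Sigma.mk.inj h).2
  obtain ⟨a, ha⟩ := QuotientGroup.eq.1 h'
  obtain ⟨a, rfl⟩ := QuotientGroup.mk_surjective a
  refine exists_smul_mk_eq l a.2 ((QuotientGroup.eq (s := normalHull H N)).1 ?_)
  exact ha

section Transversal

variable (hT : ∀ l, Subgroup.IsComplement (T l) ((H l ⊔ normalHull H N : Subgroup G) : Set G))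

/-- The coset `t H_λ` of an element `t ∈ T_λ`. -/
def baseCoset (p : Σ l, T l) : Cosets H := ⟨p.1, ((p.2 : G) : G ⧸ H p.1)⟩

theorem smul_baseCoset (p : Σ l, T l) (n : conjKernel H N p.1 p.2) :
    (conjKernelIncl H N p.1 (p.2 : G) n : G) • baseCoset (H := H) p = baseCoset p := by
  obtain ⟨_, a, ha, rfl⟩ := n
  refine (smul_mk_eq_iff _ _ _ _).2 ?_
  obtain ⟨a, -, rfl⟩ := ha
  change ((p.2 : G) * a * (p.2 : G)⁻¹ * p.2)⁻¹ * p.2 ∈ H p.1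
  convert inv_mem a.2 using 1
  group

/-- The stabiliser of tH_l in 𝒩 is t(H_l ∩ 𝒩)t⁻¹, which is tN_lt⁻¹. -/
theorem smul_baseCoset_eq_iff (hN : ∀ l, H l ⊓ normalHull H N ≤ kernelIn H N l) (p : Σ l, T l)
    (n : (proj H N).ker) : (n : G) • baseCoset (H := H) p = baseCoset p ↔
      n ∈ (conjKernelIncl H N p.1 (p.2 : G)).range := by
  refine ⟨fun h => ?_, fun ⟨c, hc⟩ => hc ▸ smul_baseCoset p c⟩
  have h1 := (smul_mk_eq_iff _ _ _ _).1 h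
  have h2 : (p.2 : G)⁻¹ * n * p.2 ∈ kernelIn H N p.1 := by
    refine hN _ ⟨?_, ?_⟩
    · change _ ∈ H p.1
      convert inv_mem h1 using 1
      group
    · simpa using (normalHull_normal H N).conj_mem _ ((ker_proj H N).le n.2) (p.2 : G)⁻¹
  refine ⟨⟨n, _, h2, ?_⟩, rfl⟩
  change (p.2 : G) * ((p.2 : G)⁻¹ * n * p.2) * (p.2 : G)⁻¹ = n
  group

include hT

/-- The 𝒩-orbits on G/H_l correspond to the cosets of H_l𝒩, each represented in T_l. The next lemma
is the uniqueness half. -/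
theorem exists_smul_baseCoset (y : Cosets H) :
    ∃ p : Σ l, T l, ∃ n : (proj H N).ker, (n : G) • baseCoset p = y := by
  obtain ⟨l, y⟩ := y
  obtain ⟨g, rfl⟩ := QuotientGroup.mk_surjective y
  obtain ⟨t, ht, -⟩ := Subgroup.isComplement_iff_existsUnique_inv_mul_mem.1 (hT l) g
  obtain ⟨a, ha, b, hb, hab⟩ := Subgroup.mem_sup_of_normal_right.1 ht
  exact ⟨⟨l, t⟩, exists_smul_mk_eq l ha (by rw [← hab]; simpa using hb)⟩

theorem eq_of_smul_baseCoset_eq (p q : Σ l, T l) (n : (proj H N).ker)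
    (h : (n : G) • baseCoset (H := H) p = baseCoset q) : p = q := by
  obtain ⟨l, t⟩ := p
  obtain ⟨l', s⟩ := q
  obtain rfl : l = l' := congrArg Sigma.fst h
  have h1 := (smul_mk_eq_iff _ _ _ _).1 h
  refine congrArg _ ((Subgroup.isComplement_iff_existsUnique_inv_mul_mem.1 (hT l) s).unique ?_ ?_)
  · have h2 := (normalHull_normal H N).conj_mem _ ((ker_proj H N).le n.2) (t : G)⁻¹
    have h3 := mul_mem (Subgroup.mem_sup_right (S := H l) h2)
      (Subgroup.mem_sup_left (T := normalHull H N) h1)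
    change (t : G)⁻¹ * s ∈ H l ⊔ normalHull H N
    convert h3 using 1
    group
  · change (s : G)⁻¹ * s ∈ H l ⊔ normalHull H N
    rw [inv_mul_cancel]
    exact one_mem _

end Transversal

section Excision

variable {k : Type u} [CommRing k] [∀ l, (N l).Normal]

theorem IsCohenLyndon.inf_normalHull_le (hCL : IsCohenLyndon H N)
    (htriv : ∀ l, N l = ⊥ → H l ⊓ normalHull H N = ⊥) (l : Λ) :
    H l ⊓ normalHull H N ≤ kernelIn H N l := by
  obtain ⟨T, hT, hinj, hrange⟩ := hCL
  exact DehnFilling.inf_normalHull_le l (hT l).nonempty_left hinj hrange (htriv l)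

theorem IsCohenLyndon.projective_res_relModule [Nonempty Λ] (hCL : IsCohenLyndon H N)
    (htriv : ∀ l, N l = ⊥ → H l ⊓ normalHull H N = ⊥) :
    Projective (Rep.res (proj H N).ker.subtype (relModule k H)) := by
  have hN := hCL.inf_normalHull_le htriv
  obtain ⟨T, hT, hinj, hrange⟩ := hCL
  obtain ⟨l⟩ := ‹Nonempty Λ›
  obtain ⟨t, ht⟩ := (hT l).nonempty_left
  have : Nonempty (Σ l, T l) := ⟨⟨l, t, ht⟩⟩
  exact GroupPair.projective_res_relModule H (bijective_lift_conjKernelIncl hinj hrange)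
    (smul_baseCoset_eq_iff hN) (exists_smul_baseCoset hT) (eq_of_smul_baseCoset_eq hT)

theorem IsCohenLyndon.mem_ker_of_relModuleMap_eq_zero (hCL : IsCohenLyndon H N)
    (v : relModule k H)
    (hv : (relModuleMap k (proj H N) (le_comap_barSubgroup H N)).hom v = 0) :
    v ∈ Representation.Coinvariants.ker ((relModule k H).ρ.comp (proj H N).ker.subtype) := by
  obtain ⟨T, hT, hinj, hrange⟩ := hCL
  exact GroupPair.mem_ker_of_relModuleMap_eq_zero _ _ (QuotientGroup.mk'_surjective _)
    (fun n y => cosetSub_smul_mem H (bijective_lift_conjKernelIncl hinj hrange)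
      smul_baseCoset n y) exists_smul_eq_of_cosetMap_eq v hv

variable [Nonempty Λ] (hCL : IsCohenLyndon H N)
  (htriv : ∀ l, N l = ⊥ → H l ⊓ normalHull H N = ⊥) (A : Rep.{u} k (Filling H N))

include hCL htriv

/-- Projectivity of Δ over 𝒩 makes k[Ḡ] ⊗ Δ projective over kG, which drives the dimension shifting;
the coinvariants of Δ settle degree 0. -/
theorem IsCohenLyndon.bijective_relHomologyMap (n : ℕ) :
    Function.Bijective (relHomologyMap (proj H N) (le_comap_barSubgroup H N) A n) := by
  have hs : Function.Surjective (proj H N) := QuotientGroup.mk'_surjective _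
  have := hCL.projective_res_relModule (k := k) htriv
  have := projective_regularRep_tensor (k := k) (proj H N) hs (relModule k H)
  exact GroupPair.bijective_relHomologyMap _ _ A (fun B => bijective_map_tensorMap_zero _ _ B hs
    (surjective_relModuleMap _ _ hs) hCL.mem_ker_of_relModuleMap_eq_zero) n

theorem IsCohenLyndon.bijective_relCohomologyMap (n : ℕ) :
    Function.Bijective (relCohomologyMap (proj H N) (le_comap_barSubgroup H N) A n) := by
  have hs : Function.Surjective (proj H N) := QuotientGroup.mk'_surjective _
  have := hCL.projective_res_relModule (k := k) htriv
  have := projective_regularRep_tensor (k := k) (proj H N) hs (relModule k H)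
  exact GroupPair.bijective_relCohomologyMap _ _ A (fun B => bijective_map_ihomMap_zero _ _ B hs
    (surjective_relModuleMap _ _ hs) hCL.mem_ker_of_relModuleMap_eq_zero) n

end Excision

end

end DehnFilling

/-! ### Replacing the relative terms, and the main theorem. -/

namespace GroupPair

variable {k : Type u} [CommRing k] {L M R R' : ℕ → Type u} [∀ n, AddCommGroup (L n)]
  [∀ n, AddCommGroup (M n)] [∀ n, AddCommGroup (R n)] [∀ n, AddCommGroup (R' n)]
  [∀ n, Module k (L n)] [∀ n, Module k (M n)] [∀ n, Module k (R n)] [∀ n, Module k (R' n)]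

theorem IsLongExactHomology.of_linearEquiv {i : ∀ n, L n →ₗ[k] M n} {j : ∀ n, M n →ₗ[k] R n}
    {d : ∀ n, R (n + 1) →ₗ[k] L n} (h : IsLongExactHomology i j d) (E : ∀ n, R' n ≃ₗ[k] R n) :
    IsLongExactHomology i (fun n => (E n).symm.toLinearMap ∘ₗ j n)
      (fun n => d n ∘ₗ (E (n + 1)).toLinearMap) where
  exact_mid n y := by simpa using h.exact_mid n y
  exact_rel n y := by
    refine (h.exact_rel n (E (n + 1) y)).trans (exists_congr fun x => ?_)
    exact ((E (n + 1)).symm_apply_eq).symm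
  exact_sub n y := (h.exact_sub n y).trans
    ⟨fun ⟨x, hx⟩ => ⟨(E (n + 1)).symm x, by simpa using hx⟩, fun ⟨x, hx⟩ => ⟨_, hx⟩⟩
  surjective_zero := (E 0).symm.surjective.comp h.surjective_zero

theorem IsLongExactCohomology.of_linearEquiv {r : ∀ n, M n →ₗ[k] L n} {p : ∀ n, R n →ₗ[k] M n}
    {d : ∀ n, L n →ₗ[k] R (n + 1)} (h : IsLongExactCohomology r p d) (E : ∀ n, R n ≃ₗ[k] R' n) :
    IsLongExactCohomology r (fun n => p n ∘ₗ (E n).symm.toLinearMap)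
      (fun n => (E (n + 1)).toLinearMap ∘ₗ d n) where
  injective_zero := h.injective_zero.comp (E 0).symm.injective
  exact_mid n y := (h.exact_mid n y).trans
    ⟨fun ⟨x, hx⟩ => ⟨E n x, by simpa using hx⟩, fun ⟨x, hx⟩ => ⟨_, hx⟩⟩
  exact_sub n y := by simpa using h.exact_sub n y
  exact_rel n y := by
    refine (h.exact_rel n ((E (n + 1)).symm y)).trans (exists_congr fun x => ?_)
    exact (E (n + 1)).eq_symm_apply

end GroupPair

open GroupPair DehnFilling in
theorem mainTheorem3 {k G Λ : Type u} [CommRing k] [Group G] [Nonempty Λ]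
    (H : Λ → Subgroup G) (N : ∀ l, Subgroup (H l)) [∀ l, (N l).Normal]
    (hCL : IsCohenLyndon H N)
    (htriv : ∀ l, N l = ⊥ → H l ⊓ normalHull H N = ⊥)
    (A : Rep.{u} k (Filling H N)) :
    -- `H̄_λ → Ḡ` is injective, so `H̄_λ` is identified with the subgroup `barSubgroup H N l`
    (∀ l, Function.Injective (barHom H N l)) ∧
    -- Shapiro's maps are isomorphisms, so the boundary maps below are uniquely determined
    (∀ n, Function.Bijective (homologyShapiro H (Rep.res (proj H N) A) n)) ∧
    (∀ n, Function.Bijective (homologyShapiro (barSubgroup H N) A n)) ∧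
    (∀ n, Function.Bijective (cohomologyShapiro H (Rep.res (proj H N) A) n)) ∧
    (∀ n, Function.Bijective (cohomologyShapiro (barSubgroup H N) A n)) ∧
    -- Homology
    (∃ (d : ∀ n, relHomology H (Rep.res (proj H N) A) (n + 1) →ₗ[k]
          subHomology H (Rep.res (proj H N) A) n)
        (dbar : ∀ n, relHomology (barSubgroup H N) A (n + 1) →ₗ[k]
          subHomology (barSubgroup H N) A n),
      (∀ n, IsHomologyBoundary H (Rep.res (proj H N) A) n (d n)) ∧
      (∀ n, IsHomologyBoundary (barSubgroup H N) A n (dbar n)) ∧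
      -- the long exact sequences of the pairs `(G, {H_λ})` and `(Ḡ, {H̄_λ})`
      IsLongExactHomology (homologyIncl H (Rep.res (proj H N) A))
        (homologyToRel H (Rep.res (proj H N) A)) d ∧
      IsLongExactHomology (homologyIncl (barSubgroup H N) A)
        (homologyToRel (barSubgroup H N) A) dbar ∧
      -- the natural ladder between them commutes
      (∀ n, homologyMap (proj H N) A n ∘ₗ homologyIncl H (Rep.res (proj H N) A) n =
        homologyIncl (barSubgroup H N) A n ∘ₗ
          subHomologyMap (proj H N) (le_comap_barSubgroup H N) A n) ∧
      (∀ n, relHomologyMap (proj H N) (le_comap_barSubgroup H N) A n ∘ₗ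
          homologyToRel H (Rep.res (proj H N) A) n =
        homologyToRel (barSubgroup H N) A n ∘ₗ homologyMap (proj H N) A n) ∧
      (∀ n, subHomologyMap (proj H N) (le_comap_barSubgroup H N) A n ∘ₗ d n =
        dbar n ∘ₗ relHomologyMap (proj H N) (le_comap_barSubgroup H N) A (n + 1)) ∧
      -- excision
      (∀ n, Function.Bijective (relHomologyMap (proj H N) (le_comap_barSubgroup H N) A n)) ∧
      -- the lower row with the relative terms of `(G, {H_λ})`, and the ladder with identities
      ∃ (j : ∀ n, groupHomology A n →ₗ[k] relHomology H (Rep.res (proj H N) A) n)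
        (e : ∀ n, relHomology H (Rep.res (proj H N) A) (n + 1) →ₗ[k]
          subHomology (barSubgroup H N) A n),
        (∀ n, relHomologyMap (proj H N) (le_comap_barSubgroup H N) A n ∘ₗ j n =
          homologyToRel (barSubgroup H N) A n) ∧
        (∀ n, dbar n ∘ₗ relHomologyMap (proj H N) (le_comap_barSubgroup H N) A (n + 1) = e n) ∧
        IsLongExactHomology (homologyIncl (barSubgroup H N) A) j e ∧
        (∀ n, homologyToRel H (Rep.res (proj H N) A) n = j n ∘ₗ homologyMap (proj H N) A n) ∧
        (∀ n, subHomologyMap (proj H N) (le_comap_barSubgroup H N) A n ∘ₗ d n = e n)) ∧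
    -- Cohomology
    (∃ (d : ∀ n, subCohomology H (Rep.res (proj H N) A) n →ₗ[k]
          relCohomology H (Rep.res (proj H N) A) (n + 1))
        (dbar : ∀ n, subCohomology (barSubgroup H N) A n →ₗ[k]
          relCohomology (barSubgroup H N) A (n + 1)),
      (∀ n, IsCohomologyCoboundary H (Rep.res (proj H N) A) n (d n)) ∧
      (∀ n, IsCohomologyCoboundary (barSubgroup H N) A n (dbar n)) ∧
      -- the long exact sequences of the pairs `(G, {H_λ})` and `(Ḡ, {H̄_λ})`
      IsLongExactCohomology (cohomologyRestr H (Rep.res (proj H N) A))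
        (relToCohomology H (Rep.res (proj H N) A)) d ∧
      IsLongExactCohomology (cohomologyRestr (barSubgroup H N) A)
        (relToCohomology (barSubgroup H N) A) dbar ∧
      -- the natural ladder between them commutes
      (∀ n, cohomologyRestr H (Rep.res (proj H N) A) n ∘ₗ cohomologyMap (proj H N) A n =
        subCohomologyMap (proj H N) (le_comap_barSubgroup H N) A n ∘ₗ
          cohomologyRestr (barSubgroup H N) A n) ∧
      (∀ n, cohomologyMap (proj H N) A n ∘ₗ relToCohomology (barSubgroup H N) A n =
        relToCohomology H (Rep.res (proj H N) A) n ∘ₗ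
          relCohomologyMap (proj H N) (le_comap_barSubgroup H N) A n) ∧
      (∀ n, relCohomologyMap (proj H N) (le_comap_barSubgroup H N) A (n + 1) ∘ₗ dbar n =
        d n ∘ₗ subCohomologyMap (proj H N) (le_comap_barSubgroup H N) A n) ∧
      -- excision
      (∀ n, Function.Bijective (relCohomologyMap (proj H N) (le_comap_barSubgroup H N) A n)) ∧
      -- the row of `Ḡ` with the relative terms of `(G, {H_λ})`, and the ladder with identities
      ∃ (p : ∀ n, relCohomology H (Rep.res (proj H N) A) n →ₗ[k] groupCohomology A n)
        (e : ∀ n, subCohomology (barSubgroup H N) A n →ₗ[k]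
          relCohomology H (Rep.res (proj H N) A) (n + 1)),
        (∀ n, p n ∘ₗ relCohomologyMap (proj H N) (le_comap_barSubgroup H N) A n =
          relToCohomology (barSubgroup H N) A n) ∧
        (∀ n, relCohomologyMap (proj H N) (le_comap_barSubgroup H N) A (n + 1) ∘ₗ dbar n = e n) ∧
        IsLongExactCohomology (cohomologyRestr (barSubgroup H N) A) p e ∧
        (∀ n, cohomologyMap (proj H N) A n ∘ₗ p n =
          relToCohomology H (Rep.res (proj H N) A) n) ∧
        (∀ n, d n ∘ₗ subCohomologyMap (proj H N) (le_comap_barSubgroup H N) A n = e n)) := by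
  have hf := le_comap_barSubgroup H N
  let B := Rep.res (proj H N) A
  let K := barSubgroup H N
  have hE := hCL.bijective_relHomologyMap htriv A
  have hE' := hCL.bijective_relCohomologyMap htriv A
  let E (n) := LinearEquiv.ofBijective _ (hE n)
  let E' (n) := LinearEquiv.ofBijective _ (hE' n)
  have hto (n) := relHomologyMap_comp_homologyToRel (proj H N) hf A n
  have hd (n) := subHomologyMap_comp_homologyBoundary (proj H N) hf A n
  have hto' (n) := cohomologyMap_comp_relToCohomology (proj H N) hf A n
  have hd' (n) := relCohomologyMap_comp_cohomologyCoboundary (proj H N) hf A n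
  refine ⟨fun l => injective_barHom l (hCL.inf_normalHull_le htriv l),
    fun n => bijective_homologyShapiro H n B, fun n => bijective_homologyShapiro K n A,
    fun n => bijective_cohomologyShapiro H n B, fun n => bijective_cohomologyShapiro K n A,
    ⟨homologyBoundary H B, homologyBoundary K A, isHomologyBoundary_homologyBoundary H B,
      isHomologyBoundary_homologyBoundary K A, isLongExactHomology H B, isLongExactHomology K A,
      homologyMap_comp_homologyIncl (proj H N) hf A, hto, hd, hE,
      -- The witnesses are fixed by unification with `of_linearEquiv`: the map to the relative term
      -- of Ḡ followed by inverse excision, and excision followed by the boundary of Ḡ.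
      _, _, fun n => LinearMap.ext fun a => (E n).apply_symm_apply _, fun n => rfl,
      (isLongExactHomology K A).of_linearEquiv E, fun n => LinearMap.ext fun a => ?_, hd⟩,
    ⟨cohomologyCoboundary H B, cohomologyCoboundary K A,
      isCohomologyCoboundary_cohomologyCoboundary H B,
      isCohomologyCoboundary_cohomologyCoboundary K A, isLongExactCohomology H B,
      isLongExactCohomology K A, cohomologyRestr_comp_cohomologyMap (proj H N) hf A, hto', hd',
      -- Dually, the witnesses are inverse excision followed by the map to Hⁿ(Ḡ; A), and the
      -- coboundary of Ḡ followed by excision.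
      hE', _, _, fun n => LinearMap.ext fun a =>
        congrArg (relToCohomology K A n) ((E' n).symm_apply_apply a), fun n => rfl,
      (isLongExactCohomology K A).of_linearEquiv E', fun n => LinearMap.ext fun a => ?_,
      fun n => (hd' n).symm⟩⟩
  · exact (E n).eq_symm_apply.2 (LinearMap.congr_fun (hto n) a)
  · exact (LinearMap.congr_fun (hto' n) ((E' n).symm a)).trans
      (congrArg (relToCohomology H B n) ((E' n).apply_symm_apply a))
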